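/- Let $(Y,\omega)$ be a pre-symplectic manifold of dimension $2k+r$: $Y$ is a smooth manifold and $\omega$ is a smooth closed two-form whose kernel $E=\ker\omega\subset TY$ has constant rank $r$. Let $\mathcal F$ be the null foliation, $E=T\mathcal F$, and let $\pi:E^*=T^*\mathcal F\to Y$ be the dual bundle. Fix a smooth splitting $TY=G\oplus E$, let $p_G:TY\to E$ be the projection along $G$, and let $\Pi:TY\to TY$ be $p_G$ followed by the inclusion. Put $\theta_G(\xi)=\alpha(p_G(T\pi\,\xi))$ for $\xi\in T_\alpha E^*$ and $\omega_U=\pi^*\omega-d\theta_G$, where $d\theta(u,v)=u(\theta(v))-v(\theta(u))-\theta([u,v])$. Let $U\subset E^*$ be an open neighbourhood of the zero section on which $\omega_U$ is non-degenerate, and let $s:Y\to U$ be a smooth section of $E^*$. Its graph is called coisotropic if $(T\,\mathrm{Graph}\,s)^{\omega_U}\subset T\,\mathrm{Graph}\,s$ and the left-hand side has constant rank. Let $(y^1,\dots,y^{2k},q^1,\dots,q^r)$ be foliation coordinates on an open set $V\subset Y$, that is, coordinates with $E=\{dy^1=\dots=dy^{2k}=0\}$, and let $(y,q,p)$ be the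 induced coordinates on $E^*$, $p_\beta(\alpha)=\alpha(\partial/\partial q^\beta)$. Write (with summation over repeated indices; Roman indices run over $1,\dots,2k$ and Greek ones over $1,\dots,r$) - $\omega_{ij}=\omega(\partial/\partial y^i,\partial/\partial y^j)$ and $s_\beta=s(\partial/\partial q^\beta)$; - $Y_i=\partial/\partial y^i+R_i^\alpha\,\partial/\partial q^\alpha$ for the component of $\partial/\partial y^i$ in $G$, and $\Pi[Y_i,Y_j]=F^\beta_{ij}\,\partial/\partial q^\beta$; - $f^*_\beta=dq^\beta-R^\beta_i\,dy^i$, the one-forms vanishing on $G$ and dual to $\partial/\partial q^\beta$ on $E$; - $G^\sharp=(T\pi^{-1}\mathcal F)^{\omega_U}$ (the leafwise symplectic connection), and $E^\sharp=\mathrm{span}\{\partial/\partial q^\alpha\}$ in the coordinates $(y,q,p)$; - $\Pi^v$ for the projection of $TE^*$ to the vertical bundle $\ker T\pi$ along $G^\sharp\oplus E^\sharp$, and $\nabla s=\Pi^v\circ ds$; $\nabla_i s_\alpha$ and $\nabla_\beta s_\alpha$ are the coefficients of $\partial/\partial p_\alpha$ in $\nabla s(Y_i)$ and $\nabla s(\partial/\partial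 q^\beta)$ respectively; - $\widetilde\omega_{ij}=\omega_{ij}+s_\beta F^\beta_{ij}$. Then, at every point $y\in V$: (a) $T_{s(y)}E^*=\ker T\pi\oplus(G^\sharp+E^\sharp)$; there is a basis $e_1,\dots,e_{2k}$ of $G^\sharp_{s(y)}$ with $T\pi(e_i)=Y_i$ and $\omega_U(e_i,e_j)=\widetilde\omega_{ij}$; and the matrix $(\widetilde\omega_{ij})$ is invertible. (b) Let $(\widetilde\omega^{ij})$ be its inverse, with the normalisation $\widetilde\omega^{ij}\widetilde\omega_{mj}=\delta^i_m$ (the components of the bilinear form induced on the dual space). The following are equivalent: the tangent space of $\mathrm{Graph}\,s$ at $s(y)$ is a coisotropic subspace of $(T_{s(y)}U,\omega_U)$; the equations $$\nabla_i s_\alpha\,\widetilde\omega^{ij}\,\nabla_j s_\beta=\nabla_\beta s_\alpha-\nabla_\alpha s_\beta\qquad\text{for all }\alpha>\beta$$ hold at $y$; the equation $$\tfrac12\big(\nabla_i s_\alpha\,\widetilde\omega^{ij}\,\nabla_j s_\beta\big)f^*_\alpha\wedge f^*_\beta=(\nabla_\beta s_\alpha)\,f^*_\alpha\wedge f^*_\beta$$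 holds at $y$. Consequently, for any collection of foliation charts covering $Y$, the graph of $s$ is a coisotropic submanifold of $(U,\omega_U)$ if and only if the master equation (in either of these two forms) holds in every chart of the collection. -/

import Mathlib

open Bundle Set Function
open scoped Manifold ContDiff Topology

noncomputable section

namespace MasterEq

/-! ### Differential forms on a manifold -/

section Forms

variable {V H : Type*} [NormedAddCommGroup V] [NormedSpace ℝ V] [TopologicalSpace H]
  (I : ModelWithCorners ℝ V H) {M : Type*} [TopologicalSpace M] [ChartedSpace H M]

/-- Differential `n`-forms on `M`, with no regularity imposed. -/
abbrev Form (M : Type*) [TopologicalSpace M] [ChartedSpace H M] (n : ℕ) : Type _ :=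
  (x : M) → (TangentSpace I x) [⋀^Fin n]→L[ℝ] ℝ

variable {I}

/-- The coordinate expression of a form in the preferred chart at `x₀`: its pullback under the
inverse of the chart. -/
def Form.inChart {n : ℕ} (η : Form I M n) (x₀ : M) : V → V [⋀^Fin n]→L[ℝ] ℝ := fun z =>
  (η ((extChartAt I x₀).symm z)).compContinuousLinearMap
    (mfderivWithin 𝓘(ℝ, V) I (extChartAt I x₀).symm (range I) z)

/-- A form is smooth if all its coordinate expressions are. -/
def Form.Smooth {n : ℕ} (η : Form I M n) : Prop :=
  ∀ x₀ : M, ContDiffOn ℝ ∞ (η.inChart x₀) (extChartAt I x₀).target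

/-- The exterior derivative of a form on a manifold, computed at `x` in the preferred chart
at `x` (normalised so that `dθ (u, v) = u (θ v) - v (θ u) - θ [u, v]` for one-forms). -/
def Form.d {n : ℕ} (η : Form I M n) : Form I M (n + 1) := fun x =>
  (extDerivWithin (η.inChart x) (range I) (extChartAt I x x)).compContinuousLinearMap
    (mfderiv I 𝓘(ℝ, V) (extChartAt I x) x)

/-- The orthogonal complement `W^η` of a subspace `W` of a tangent space with respect to a
two-form `η`. -/
def Form.orth (η : Form I M 2) {x : M} (W : Submodule ℝ (TangentSpace I x)) :
    Submodule ℝ (TangentSpace I x) where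
  carrier := {v | ∀ w ∈ W, η x ![v, w] = 0}
  zero_mem' := fun w _ => (η x).map_coord_zero (m := ![0, w]) 0 rfl
  add_mem' := by
    intro a b ha hb w hw
    have h := (η x).map_update_add ![a, w] 0 a b
    have e : ∀ c : TangentSpace I x, Function.update ![a, w] 0 c = ![c, w] := by
      intro c; ext i; fin_cases i <;> rfl
    rw [e, e, e] at h
    rw [h, ha w hw, hb w hw, add_zero]
  smul_mem' := by
    intro c a ha w hw
    have h := (η x).map_update_smul ![a, w] 0 c a
    have e : ∀ c : TangentSpace I x, Function.update ![a, w] 0 c = ![c, w] := by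
      intro c; ext i; fin_cases i <;> rfl
    rw [e, e] at h
    rw [h, ha w hw, smul_zero]

/-- The kernel of a two-form at a point. -/
def Form.ker (η : Form I M 2) (x : M) : Submodule ℝ (TangentSpace I x) :=
  η.orth ⊤

/-- A pre-symplectic form: a smooth closed two-form whose kernel has constant dimension `r`. -/
structure Form.IsPresymplectic (η : Form I M 2) (r : ℕ) : Prop where
  smooth : η.Smooth
  closed : η.d = 0
  finrank_ker : ∀ x, Module.finrank ℝ (η.ker x) = r

end Forms

/-- The wedge product of two covectors, as a bilinear form. -/
def wedge {T : Type*} [AddCommGroup T] [Module ℝ T] (a b : T →ₗ[ℝ] ℝ) : T →ₗ[ℝ] T →ₗ[ℝ] ℝ :=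
  a.smulRight b - b.smulRight a

open Classical in
/-- The projection onto the subspace `A` along its complement `B`
(zero if the two subspaces are not complementary). -/
def projAlong {T : Type*} [AddCommGroup T] [Module ℝ T] (A B : Submodule ℝ T) : T →ₗ[ℝ] T :=
  if h : IsCompl A B then A.projection B h else 0

/-! ### The null distribution as a vector bundle, splittings, and the thickening -/

section Thickening

variable {k r : ℕ} {Y : Type*} [TopologicalSpace Y]
  [ChartedSpace (EuclideanSpace ℝ (Fin (2 * k + r))) Y] [IsManifold (𝓡 (2 * k + r)) ∞ Y]

/-- The model fibre of the null distribution `E`. -/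
abbrev Fib (r : ℕ) : Type := EuclideanSpace ℝ (Fin r)

/-- The model fibre of the dual bundle `E*`. -/
abbrev DualFib (r : ℕ) : Type := Fib r →L[ℝ] ℝ

/-- The characteristic distribution `E = (TY)^ω = ker ω` as a family of vector spaces over `Y`;
it is the tangent bundle of the null foliation. -/
abbrev NullDist (Ω : Form (𝓡 (2 * k + r)) Y 2) : Y → Type _ := fun y => Ω.ker y

variable (Ω : Form (𝓡 (2 * k + r)) Y 2) [TopologicalSpace (TotalSpace (Fib r) (NullDist Ω))]
  [FiberBundle (Fib r) (NullDist Ω)] [VectorBundle ℝ (Fib r) (NullDist Ω)]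

/-- The vector bundle structure on `E = ker ω` is that of a smooth subbundle of `TY`:
the inclusion `E → TY` is a smooth bundle map. -/
def IsSubbundle : Prop :=
  ContMDiff (𝓡 (2 * k + r))
    ((𝓡 (2 * k + r)).prod 𝓘(ℝ, Fib r →L[ℝ] EuclideanSpace ℝ (Fin (2 * k + r)))) ∞
    (fun y => TotalSpace.mk' (Fib r →L[ℝ] EuclideanSpace ℝ (Fin (2 * k + r)))
      (E := fun y => NullDist Ω y →L[ℝ] TangentSpace (𝓡 (2 * k + r)) y) y (Ω.ker y).subtypeL)

/-- A splitting `TY = G ⊕ E`, given by the smooth projection `p_G : TY → E` along `G = ker p_G`. -/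
structure Splitting where
  pG : (y : Y) → TangentSpace (𝓡 (2 * k + r)) y →L[ℝ] NullDist Ω y
  smooth_pG : ContMDiff (𝓡 (2 * k + r))
    ((𝓡 (2 * k + r)).prod 𝓘(ℝ, EuclideanSpace ℝ (Fin (2 * k + r)) →L[ℝ] Fib r)) ∞
    (fun y => TotalSpace.mk' (EuclideanSpace ℝ (Fin (2 * k + r)) →L[ℝ] Fib r)
      (E := fun y => TangentSpace (𝓡 (2 * k + r)) y →L[ℝ] NullDist Ω y) y (pG y))
  pG_apply_coe : ∀ y (e : NullDist Ω y), pG y e = e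

variable {Ω}

/-- The projection `Π : TY → TY` with image `E` and kernel `G`. -/
def Splitting.proj (S : Splitting Ω) (y : Y) :
    TangentSpace (𝓡 (2 * k + r)) y →L[ℝ] TangentSpace (𝓡 (2 * k + r)) y :=
  (Ω.ker y).subtypeL.comp (S.pG y)

variable (Ω) in
/-- The total space of the dual bundle `E* = T*F`. -/
abbrev EDual : Type _ := TotalSpace (DualFib r) (fun y : Y => NullDist Ω y →L[ℝ] ℝ)

variable (k r) in
/-- The model with corners of the manifold `E*`. -/
abbrev IDual : ModelWithCorners ℝ (EuclideanSpace ℝ (Fin (2 * k + r)) × DualFib r)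
    (ModelProd (EuclideanSpace ℝ (Fin (2 * k + r))) (DualFib r)) :=
  (𝓡 (2 * k + r)).prod 𝓘(ℝ, DualFib r)

/-- The derivative `Tπ` of the projection `π : E* → Y`. -/
def dπ (l : EDual Ω) :
    TangentSpace (IDual k r) l →L[ℝ] TangentSpace (𝓡 (2 * k + r)) l.proj :=
  mfderiv (IDual k r) (𝓡 (2 * k + r)) (fun l : EDual Ω => l.proj) l

variable (S : Splitting Ω)

/-- The one-form `θ_G` on `E*`, `θ_G (ξ) = α (p_G (Tπ ξ))` for `ξ ∈ T_α E*`. -/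
def Splitting.theta : Form (IDual k r) (EDual Ω) 1 := fun l =>
  ContinuousAlternatingMap.ofSubsingleton ℝ _ ℝ (0 : Fin 1) (l.snd.comp ((S.pG l.proj).comp (dπ l)))

/-- The two-form `π^* ω - dθ_G` on `E*`. -/
def Splitting.omega : Form (IDual k r) (EDual Ω) 2 := fun l =>
  (Ω l.proj).compContinuousLinearMap (dπ l) - S.theta.d l

/-- `U` is a thickening of `Y`: an open neighbourhood of the zero section in `E*` on which
`π^* ω - dθ_G` is non-degenerate. -/
structure Splitting.IsThickening (U : Set (EDual Ω)) : Prop where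
  isOpen : IsOpen U
  zero_mem : ∀ y : Y, (⟨y, 0⟩ : EDual Ω) ∈ U
  nondegenerate : ∀ l ∈ U, S.omega.ker l = ⊥

/-- A section `s` of `E*` as a map `Y → E*`. -/
def graphMap (s : (y : Y) → NullDist Ω y →L[ℝ] ℝ) : Y → EDual Ω := fun y => ⟨y, s y⟩

/-- The derivative `ds : T_y Y → T_{s(y)} E*`. -/
def dSec (s : (y : Y) → NullDist Ω y →L[ℝ] ℝ) (y : Y) :
    TangentSpace (𝓡 (2 * k + r)) y →L[ℝ] TangentSpace (IDual k r) (graphMap s y) :=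
  mfderiv (𝓡 (2 * k + r)) (IDual k r) (graphMap s) y

/-- The tangent space of `Graph s` at `s(y)`. -/
def graphTangent (s : (y : Y) → NullDist Ω y →L[ℝ] ℝ) (y : Y) :
    Submodule ℝ (TangentSpace (IDual k r) (graphMap s y)) :=
  LinearMap.range (dSec s y).toLinearMap

/-- The tangent space of `Graph s` at `s(y)` is a coisotropic subspace. -/
def Splitting.IsCoisotropicAt (s : (y : Y) → NullDist Ω y →L[ℝ] ℝ) (y : Y) : Prop :=
  S.omega.orth (graphTangent s y) ≤ graphTangent s y

/-- `Graph s` is a coisotropic submanifold: the symplectic orthogonal of its tangent bundle is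
contained in the tangent bundle and has constant rank. -/
def Splitting.IsCoisotropicGraph (s : (y : Y) → NullDist Ω y →L[ℝ] ℝ) : Prop :=
  (∀ y, S.IsCoisotropicAt s y) ∧
    ∃ d : ℕ, ∀ y, Module.finrank ℝ (S.omega.orth (graphTangent s y)) = d

/-! ### Foliation coordinates -/

/-- Foliation coordinates `(y¹, …, y²ᵏ, q¹, …, qʳ)` for the null foliation of `ω` on an open
subset of `Y`: a smooth chart such that `ker ω` is given by `dy¹ = … = dy²ᵏ = 0`. -/
structure FoliationChart (Ω : Form (𝓡 (2 * k + r)) Y 2) where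
  chart : OpenPartialHomeomorph Y (EuclideanSpace ℝ (Fin (2 * k)) × EuclideanSpace ℝ (Fin r))
  smooth : ContMDiffOn (𝓡 (2 * k + r))
    𝓘(ℝ, EuclideanSpace ℝ (Fin (2 * k)) × EuclideanSpace ℝ (Fin r)) ∞ chart chart.source
  smooth_symm : ContMDiffOn 𝓘(ℝ, EuclideanSpace ℝ (Fin (2 * k)) × EuclideanSpace ℝ (Fin r))
    (𝓡 (2 * k + r)) ∞ chart.symm chart.target
  mem_ker_iff : ∀ y ∈ chart.source, ∀ v : TangentSpace (𝓡 (2 * k + r)) y,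
    v ∈ Ω.ker y ↔ (mfderiv (𝓡 (2 * k + r))
      𝓘(ℝ, EuclideanSpace ℝ (Fin (2 * k)) × EuclideanSpace ℝ (Fin r)) chart y v).1 = 0

namespace FoliationChart

variable (φ : FoliationChart Ω)

/-- The derivative of the coordinate map at `y`. -/
def deriv (y : Y) : TangentSpace (𝓡 (2 * k + r)) y →L[ℝ]
    EuclideanSpace ℝ (Fin (2 * k)) × EuclideanSpace ℝ (Fin r) :=
  mfderiv (𝓡 (2 * k + r))
    𝓘(ℝ, EuclideanSpace ℝ (Fin (2 * k)) × EuclideanSpace ℝ (Fin r)) φ.chart y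

/-- The coordinate vector field `∂/∂yⁱ`. -/
def dy (i : Fin (2 * k)) (y : Y) : TangentSpace (𝓡 (2 * k + r)) y :=
  (φ.deriv y).inverse (EuclideanSpace.single i 1, 0)

/-- The coordinate vector field `∂/∂q^α`. -/
def dq (a : Fin r) (y : Y) : TangentSpace (𝓡 (2 * k + r)) y :=
  (φ.deriv y).inverse (0, EuclideanSpace.single a 1)

/-- The component `dq^β (v)` of a tangent vector `v`. -/
def qComp (b : Fin r) (y : Y) : TangentSpace (𝓡 (2 * k + r)) y →ₗ[ℝ] ℝ where
  toFun v := (φ.deriv y v).2 b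
  map_add' := by simp
  map_smul' := by simp

/-- The component `ω_ij = ω (∂/∂yⁱ, ∂/∂yʲ)`. -/
def omegaComp (i j : Fin (2 * k)) (y : Y) : ℝ := Ω y ![φ.dy i y, φ.dy j y]

/-- The vector field `Y_i = ∂/∂yⁱ + R_i^α ∂/∂q^α`: the component in `G` of `∂/∂yⁱ`. -/
def hor (i : Fin (2 * k)) (y : Y) : TangentSpace (𝓡 (2 * k + r)) y :=
  φ.dy i y - S.proj y (φ.dy i y)

/-- The components `F^β_ij = dq^β (Π [Y_i, Y_j])` of the transverse `Π`-curvature. -/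
def curv (i j : Fin (2 * k)) (b : Fin r) (y : Y) : ℝ :=
  φ.qComp b y (S.proj y
    (VectorField.mlieBracket (𝓡 (2 * k + r)) (φ.hor S i) (φ.hor S j) y))

/-- The covector `f_β^* = dq^β - R^β_i dyⁱ` on `Y`: it vanishes on `G`, and on `E` it is dual to
the frame `∂/∂q^α`. -/
def fstar (b : Fin r) (y : Y) : TangentSpace (𝓡 (2 * k + r)) y →ₗ[ℝ] ℝ :=
  φ.qComp b y ∘ₗ (S.proj y).toLinearMap

/-- The fibre coordinates `p_β (α) = α (∂/∂q^β)` of `α ∈ E*`; so `s_β (y) = p_β (s (y))`. -/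
def pCoord (l : EDual Ω) (b : Fin r) : ℝ :=
  l.snd (S.pG l.proj (φ.dq b l.proj))

/-- The canonical coordinates `(y, q, p)` on `E*`. -/
def coord (l : EDual Ω) :
    (EuclideanSpace ℝ (Fin (2 * k)) × EuclideanSpace ℝ (Fin r)) × EuclideanSpace ℝ (Fin r) :=
  (φ.chart l.proj, WithLp.toLp 2 (φ.pCoord S l))

/-- The derivative of the canonical coordinates at a point of `E*`. -/
def coordDeriv (l : EDual Ω) : TangentSpace (IDual k r) l →L[ℝ]
    (EuclideanSpace ℝ (Fin (2 * k)) × EuclideanSpace ℝ (Fin r)) × EuclideanSpace ℝ (Fin r) :=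
  mfderiv (IDual k r) 𝓘(ℝ, (EuclideanSpace ℝ (Fin (2 * k)) × EuclideanSpace ℝ (Fin r)) ×
    EuclideanSpace ℝ (Fin r)) (φ.coord S) l

/-- The coordinate vector `f_α = ∂/∂q^α` on `E*`, in the coordinates `(y, q, p)`. -/
def f (a : Fin r) (l : EDual Ω) : TangentSpace (IDual k r) l :=
  (φ.coordDeriv S l).inverse ((0, EuclideanSpace.single a 1), 0)

/-- The local lift `E^♯ = span {f_1, …, f_r}` of `E`. -/
def ESharp (l : EDual Ω) : Submodule ℝ (TangentSpace (IDual k r) l) :=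
  Submodule.span ℝ (range fun a => φ.f S a l)

end FoliationChart

/-- The tangent space of the foliation `π⁻¹ F` of `E*`. -/
def foliationTangent (l : EDual Ω) :
    Submodule ℝ (TangentSpace (IDual k r) l) :=
  (Ω.ker l.proj).comap (dπ l).toLinearMap

/-- The leafwise symplectic connection `G^♯`: the symplectic orthogonal of `T π⁻¹ F`. -/
def Splitting.GSharp (l : EDual Ω) : Submodule ℝ (TangentSpace (IDual k r) l) :=
  S.omega.orth (foliationTangent l)

/-- The vertical tangent space of `E*`. -/
def vertical (l : EDual Ω) : Submodule ℝ (TangentSpace (IDual k r) l) :=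
  LinearMap.ker (dπ l).toLinearMap

namespace FoliationChart

variable (φ : FoliationChart Ω)

/-- The vertical projection `Π^v` along `G^♯ ⊕ E^♯`. -/
def vertProj (l : EDual Ω) : TangentSpace (IDual k r) l →ₗ[ℝ] TangentSpace (IDual k r) l :=
  projAlong (vertical l) (S.GSharp l ⊔ φ.ESharp S l)

/-- The component `(∇_v s)_α` of the covariant derivative `∇ s = Π^v ∘ ds` in the direction `v`:
the coefficient of `∂/∂p_α` in `Π^v (ds (v))`. -/
def nabla (s : (y : Y) → NullDist Ω y →L[ℝ] ℝ) (y : Y) (v : TangentSpace (𝓡 (2 * k + r)) y)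
    (a : Fin r) : ℝ :=
  (φ.coordDeriv S (graphMap s y)
    (φ.vertProj S (graphMap s y) (dSec s y v))).2 a

/-- `∇_i s_α`, the derivative in the direction of `e_i`, that is, of `Y_i`. -/
def nablaG (s : (y : Y) → NullDist Ω y →L[ℝ] ℝ) (y : Y) (i : Fin (2 * k)) (a : Fin r) : ℝ :=
  φ.nabla S s y (φ.hor S i y) a

/-- `∇_β s_α`, the derivative in the direction of `∂/∂q^β`. -/
def nablaE (s : (y : Y) → NullDist Ω y →L[ℝ] ℝ) (y : Y) (b a : Fin r) : ℝ :=
  φ.nabla S s y (φ.dq b y) a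

/-- The matrix `ω̃_ij = ω_ij + s_β F^β_ij` at `y`. -/
def omegaTilde (s : (y : Y) → NullDist Ω y →L[ℝ] ℝ) (y : Y) : Matrix (Fin (2 * k)) (Fin (2 * k)) ℝ :=
  Matrix.of fun i j =>
    φ.omegaComp i j y + ∑ b, φ.pCoord S (graphMap s y) b * φ.curv S i j b y

/-- The coefficients `ω̃^ij` of the bilinear form induced on the dual space by `ω̃_ij`, that is,
the inverse of `ω̃_ij` normalised by `ω̃^ij ω̃_mj = δ^i_m`. -/
def omegaTildeInv (s : (y : Y) → NullDist Ω y →L[ℝ] ℝ) (y : Y) :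
    Matrix (Fin (2 * k)) (Fin (2 * k)) ℝ :=
  ((φ.omegaTilde S s y)⁻¹).transpose

/-- `∇_i s_α ω̃^ij ∇_j s_β`. -/
def quad (s : (y : Y) → NullDist Ω y →L[ℝ] ℝ) (y : Y) (a b : Fin r) : ℝ :=
  ∑ i, ∑ j, φ.nablaG S s y i a * φ.omegaTildeInv S s y i j * φ.nablaG S s y j b

/-- The master equation at `y`, in components. -/
def MasterComp (s : (y : Y) → NullDist Ω y →L[ℝ] ℝ) (y : Y) : Prop :=
  ∀ a b : Fin r, b < a → φ.quad S s y a b = φ.nablaE S s y b a - φ.nablaE S s y a b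

/-- The master equation at `y`, as an equality of two-forms
`½ (∇_i s_α ω̃^ij ∇_j s_β) f_α^* ∧ f_β^* = (∇_β s_α) f_α^* ∧ f_β^*`. -/
def MasterForm (s : (y : Y) → NullDist Ω y →L[ℝ] ℝ) (y : Y) : Prop :=
  ∑ a, ∑ b, ((1 / 2 : ℝ) * φ.quad S s y a b) • wedge (φ.fstar S a y) (φ.fstar S b y) =
    ∑ a, ∑ b, φ.nablaE S s y b a • wedge (φ.fstar S a y) (φ.fstar S b y)

end FoliationChart

end Thickening

end MasterEq

end

/-! In a foliation chart, `p_G` is `v ↦ f_b^*(v) ∂/∂q^b`, so θ_G = p_b f_b^* with f_b^* = dq^b −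
R_i^b dyⁱ. Differentiating, ω_U = β − dp_b ∧ f_b^*, where β = ω + p_b dR_i^b ∧ dyⁱ is pulled back
from the base (`omega_apply`). The y-components of the Y_i are constant, so [Y_i, Y_j] is tangent to
E and F^b_ij = Y_i R_j^b − Y_j R_i^b (`curv_eq`); hence β(Y_i, Y_j) = ω̃_ij (`baseForm_hor`).

At a point the rest is linear algebra. Lift Y_i to e_i with dp_b(e_i) = −β(∂/∂q^b, Y_i), and put E_a
= ∂/∂q^a, P_a = ∂/∂p_a. In this frame ω_U is block diagonal: ω̃ on the e_i, and the standard pairing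
between the E_a and the P_a (`adaptedFrame`). So the e_i span G^♯, the P_a span the vertical space,
and non-degeneracy makes ω̃ invertible.

With N = (∇_i s_a) and M = (∇_b s_a), the tangent space of the graph consists of the vectors with
coordinates (h, x, Nᵀh + Mᵀx). Its orthogonal consists of those with ω̃ᵀh = −Nx and y = Mx
(`comb_mem_orth_iff`). Inclusion of the second in the first is the matrix identity Nᵀ ω̃⁻ᵀ N = Mᵀ −
M (`orth_le_iff`), the master equation. Both sides are antisymmetric, so the entries a > b suffice,
and the identity is equivalent to one between two-forms. The orthogonal always has dimension r, so
constancy of its rank is automatic (`finrank_orth`). -/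

noncomputable section

set_option linter.unusedSectionVars false

namespace MasterEq

/-! ### Alternating two-forms as bilinear forms. -/

section TwoForms

variable {T : Type*} [AddCommGroup T] [Module ℝ T] [TopologicalSpace T]

/-- An alternating two-form as a bilinear form. -/
def toBilin (η : T [⋀^Fin 2]→L[ℝ] ℝ) : T →ₗ[ℝ] T →ₗ[ℝ] ℝ :=
  have e₀ (u v c : T) : Function.update ![u, v] 0 c = ![c, v] := by
    ext i; fin_cases i <;> rfl
  have e₁ (u v c : T) : Function.update ![u, v] 1 c = ![u, c] := by
    ext i; fin_cases i <;> rfl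
  LinearMap.mk₂ ℝ (fun u v => η ![u, v])
    (fun u u' v => by simpa only [e₀] using η.map_update_add ![u, v] 0 u u')
    (fun c u v => by simpa only [e₀] using η.map_update_smul ![u, v] 0 c u)
    (fun u v v' => by simpa only [e₁] using η.map_update_add ![u, v] 1 v v')
    (fun c u v => by simpa only [e₁] using η.map_update_smul ![u, v] 1 c v)

@[simp]
theorem toBilin_apply (η : T [⋀^Fin 2]→L[ℝ] ℝ) (u v : T) : toBilin η u v = η ![u, v] := rfl

theorem toBilin_self (η : T [⋀^Fin 2]→L[ℝ] ℝ) (u : T) : toBilin η u u = 0 :=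
  η.map_eq_zero_of_eq ![u, u] (i := 0) (j := 1) rfl (by simp)

theorem toBilin_swap (η : T [⋀^Fin 2]→L[ℝ] ℝ) (u v : T) : toBilin η u v = -toBilin η v u := by
  have h := toBilin_self η (u + v)
  simp only [map_add, LinearMap.add_apply, toBilin_self, zero_add, add_zero] at h
  linarith

end TwoForms

/-! ### The exterior derivative of a one-form ∑ a_j db_j. -/

section ExteriorDerivative

/-- The exterior derivative of `∑ a_j db_j` on a normed space is `∑ da_j ∧ db_j`. -/
theorem extDeriv_apply_of_eq_sum_mul_fderiv {ι V : Type*} [Fintype ι] [NormedAddCommGroup V]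
    [NormedSpace ℝ V] {η : V → V [⋀^Fin 1]→L[ℝ] ℝ} {a b : ι → V → ℝ} {x : V}
    (hη : ∀ᶠ z in 𝓝 x, ∀ v, η z v = ∑ j, a j z * fderiv ℝ (b j) z (v 0))
    (ha : ∀ j, DifferentiableAt ℝ (a j) x) (hb : ∀ j, ContDiffAt ℝ 2 (b j) x) (u v : V) :
    extDeriv η x ![u, v] = ∑ j, (fderiv ℝ (a j) x u * fderiv ℝ (b j) x v -
      fderiv ℝ (a j) x v * fderiv ℝ (b j) x u) := by
  have hb' : ∀ j, DifferentiableAt ℝ (fderiv ℝ (b j)) x := fun j =>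
    ((hb j).fderiv_right (m := 1) (by norm_num)).differentiableAt one_ne_zero
  -- The hypothesis only describes values of η; writing η as the image of a covector field under a
  -- linear isometry gives its differentiability as a form-valued map.
  have hη' : η =ᶠ[𝓝 x] fun z => ContinuousAlternatingMap.ofSubsingletonLIE (𝕜 := ℝ) (E := V) (F := ℝ) (0 : Fin 1)
      (∑ j, a j z • fderiv ℝ (b j) z) := by
    filter_upwards [hη] with z hz
    ext w
    rw [hz]
    simp [ContinuousAlternatingMap.ofSubsingletonLIE]
  have hd : DifferentiableAt ℝ η x := by
    refine DifferentiableAt.congr_of_eventuallyEq ?_ hη'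
    refine (ContinuousAlternatingMap.ofSubsingletonLIE (𝕜 := ℝ) (E := V) (F := ℝ) (0 : Fin 1)).differentiableAt.comp x ?_
    exact DifferentiableAt.fun_sum fun j _ => (ha j).smul (hb' j)
  have key : ∀ u' v' : V, fderiv ℝ (fun z => η z ![v']) x u' =
      ∑ j, (fderiv ℝ (a j) x u' * fderiv ℝ (b j) x v' +
        a j x * fderiv ℝ (fderiv ℝ (b j)) x u' v') := by
    intro u' v'
    have h1 : (fun z => η z ![v']) =ᶠ[𝓝 x] fun z => ∑ j, a j z * fderiv ℝ (b j) z v' := by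
      filter_upwards [hη] with z hz
      simp [hz]
    have h2 : ∀ j, HasFDerivAt (fun z => fderiv ℝ (b j) z v')
        ((fderiv ℝ (fderiv ℝ (b j)) x).flip v') x := fun j => by
      simpa using (hb' j).hasFDerivAt.clm_apply (hasFDerivAt_const v' x)
    have h3 : HasFDerivAt (fun z => ∑ j, a j z * fderiv ℝ (b j) z v') _ x :=
      HasFDerivAt.fun_sum fun j _ => ((ha j).hasFDerivAt.mul (h2 j))
    rw [h1.fderiv_eq, h3.fderiv]
    simp only [sum_apply]
    refine Finset.sum_congr rfl fun j _ => ?_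
    simp
    ring
  rw [extDeriv_apply hd, Fin.sum_univ_two]
  have e0 : (0 : Fin 2).removeNth ![u, v] = ![v] := by ext i; fin_cases i; rfl
  have e1 : (1 : Fin 2).removeNth ![u, v] = ![u] := by ext i; fin_cases i; rfl
  rw [e0, e1, key, key]
  simp only [Fin.val_zero, pow_zero, one_smul, Fin.val_one, pow_one, neg_smul,
    Matrix.cons_val_zero, Matrix.cons_val_one]
  rw [← sub_eq_add_neg, ← Finset.sum_sub_distrib]
  refine Finset.sum_congr rfl fun j _ => ?_
  -- The terms a_j D²b_j cancel by symmetry of the second derivative.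
  rw [((hb j).isSymmSndFDerivAt (by simp)).eq u v]
  ring

variable {V H : Type*} [NormedAddCommGroup V] [NormedSpace ℝ V] [TopologicalSpace H]
  {I : ModelWithCorners ℝ V H} [I.Boundaryless] {M : Type*} [TopologicalSpace M]
  [ChartedSpace H M] [IsManifold I ∞ M]

variable (I) in
/-- The differential of a scalar function, as a covector. -/
def scalarDiff (g : M → ℝ) (x : M) : TangentSpace I x →L[ℝ] ℝ := mfderiv I 𝓘(ℝ, ℝ) g x

/-- The exterior derivative of `∑ a_j db_j` on a manifold is `∑ da_j ∧ db_j`. -/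
theorem Form.d_apply_of_eq_sum_mul_mfderiv {ι : Type*} [Fintype ι] {η : Form I M 1}
    {a b : ι → M → ℝ} {x : M}
    (hη : ∀ᶠ z in 𝓝 x, ∀ v : Fin 1 → TangentSpace I z,
      η z v = ∑ j, a j z * scalarDiff I (b j) z (v 0))
    (ha : ∀ j, ContMDiffAt I 𝓘(ℝ, ℝ) ∞ (a j) x) (hb : ∀ j, ContMDiffAt I 𝓘(ℝ, ℝ) ∞ (b j) x)
    (u v : TangentSpace I x) :
    η.d x ![u, v] = ∑ j, (scalarDiff I (a j) x u * scalarDiff I (b j) x v -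
      scalarDiff I (a j) x v * scalarDiff I (b j) x u) := by
  set ψ := extChartAt I x with hψ
  have hx : ψ.symm (ψ x) = x := extChartAt_to_inv x
  have htgt : ψ.target ∈ 𝓝 (ψ x) := extChartAt_target_mem_nhds x
  have hsymm : ∀ z ∈ ψ.target, ContMDiffAt 𝓘(ℝ, V) I ∞ ψ.symm z := fun z hz =>
    (contMDiffOn_extChartAt_symm x).contMDiffAt ((isOpen_extChartAt_target x).mem_nhds hz)
  have hsmooth : ∀ g : M → ℝ, ContMDiffAt I 𝓘(ℝ, ℝ) ∞ g x →
      ContDiffAt ℝ ∞ (g ∘ ψ.symm) (ψ x) := fun g hg => by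
    rw [← contMDiffAt_iff_contDiffAt]
    exact ContMDiffAt.comp _ (by rwa [hx]) (hsymm _ (mem_extChartAt_target x))
  have hcont : Filter.Tendsto ψ.symm (𝓝 (ψ x)) (𝓝 x) := by
    have := (hsymm _ (mem_extChartAt_target x)).continuousAt
    rwa [ContinuousAt, hx] at this
  have hb1 : ∀ᶠ z in 𝓝 x, ∀ j, MDifferentiableAt I 𝓘(ℝ, ℝ) (b j) z :=
    Filter.eventually_all.2 fun j => by
      have := (contMDiffAt_iff_contMDiffAt_nhds (n := 1) (by simp)).1 ((hb j).of_le (by simp))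
      filter_upwards [this] with z hz using hz.mdifferentiableAt one_ne_zero
  -- By the chain rule the chart turns db_j into d(b_j ∘ ψ⁻¹), so the coordinate expression has the
  -- shape handled on a normed space.
  have hchart : ∀ᶠ z in 𝓝 (ψ x), ∀ w, η.inChart x z w =
      ∑ j, (a j ∘ ψ.symm) z * fderiv ℝ (b j ∘ ψ.symm) z (w 0) := by
    filter_upwards [htgt, hcont.eventually hη, hcont.eventually hb1] with z hz h1 h2 w
    refine (h1 _).trans ?_
    refine Finset.sum_congr rfl fun j _ => ?_
    have h3 : MDifferentiableAt 𝓘(ℝ, V) I ψ.symm z :=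
      (hsymm z hz).mdifferentiableAt (by simp)
    rw [← mfderiv_eq_fderiv, mfderiv_comp z (h2 j) h3, I.range_eq_univ, mfderivWithin_univ]
    rfl
  obtain ⟨D, hD⟩ : ∃ D : TangentSpace I x →L[ℝ] V, D = mfderiv I 𝓘(ℝ, V) ψ x := ⟨_, rfl⟩
  have hd : ∀ g : M → ℝ, ContMDiffAt I 𝓘(ℝ, ℝ) ∞ g x → ∀ w : TangentSpace I x,
      fderiv ℝ (g ∘ ψ.symm) (ψ x) (D w) = scalarDiff I g x w := by
    intro g hg w
    have h1 : MDifferentiableAt 𝓘(ℝ, V) 𝓘(ℝ, ℝ) (g ∘ ψ.symm) (ψ x) :=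
      ((hsmooth g hg).differentiableAt (by simp)).mdifferentiableAt
    have h2 : MDifferentiableAt I 𝓘(ℝ, V) ψ x := mdifferentiableAt_extChartAt (mem_chart_source H x)
    have h3 : (g ∘ ψ.symm) ∘ ψ =ᶠ[𝓝 x] g := by
      filter_upwards [extChartAt_source_mem_nhds (I := I) x] with z hz
      exact congrArg g (ψ.left_inv hz)
    have h4 : mfderiv I 𝓘(ℝ, ℝ) g x = (mfderiv 𝓘(ℝ, V) 𝓘(ℝ, ℝ) (g ∘ ψ.symm) (ψ x)).comp
        (mfderiv I 𝓘(ℝ, V) ψ x) := by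
      rw [← mfderiv_comp x h1 h2]
      exact h3.mfderiv_eq.symm
    rw [hD, scalarDiff, h4, mfderiv_eq_fderiv]
    rfl
  have h0 : η.d x ![u, v] = extDeriv (η.inChart x) (ψ x) ![D u, D v] := by
    have e : ![D u, D v] = D ∘ ![u, v] := by
      ext i; fin_cases i <;> rfl
    rw [e, hD, ← extDerivWithin_univ, ← I.range_eq_univ]
    rfl
  rw [h0, extDeriv_apply_of_eq_sum_mul_fderiv hchart
    (fun j => (hsmooth _ (ha j)).differentiableAt (by simp))
    (fun j => (hsmooth _ (hb j)).of_le (by norm_cast))]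
  refine Finset.sum_congr rfl fun j _ => ?_
  rw [hd _ (ha j), hd _ (ha j), hd _ (hb j), hd _ (hb j)]

theorem scalarDiff_mul {f g : M → ℝ} {x : M} (hf : ContMDiffAt I 𝓘(ℝ, ℝ) ∞ f x)
    (hg : ContMDiffAt I 𝓘(ℝ, ℝ) ∞ g x) (u : TangentSpace I x) :
    scalarDiff I (fun z => f z * g z) x u =
      scalarDiff I f x u * g x + f x * scalarDiff I g x u := by
  have h := ((hf.mdifferentiableAt (by simp)).hasMFDerivAt.mul
    (hg.mdifferentiableAt (by simp)).hasMFDerivAt).mfderiv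
  refine (DFunLike.congr_fun h u).trans ?_
  change f x * scalarDiff I g x u + g x * scalarDiff I f x u = _
  ring

theorem scalarDiff_neg (f : M → ℝ) (x : M) (u : TangentSpace I x) :
    scalarDiff I (fun z => -f z) x u = -scalarDiff I f x u := by
  have h := mfderiv_neg (I := I) (f := f) (x := x)
  exact DFunLike.congr_fun h u

/-- The exterior derivative of `∑ p_b (dq_b - ∑ R_i^b dy_i)`. -/
theorem Form.d_apply_of_eq_sum_mul_sub {ι κ : Type*} [Fintype ι] [Fintype κ] {η : Form I M 1}
    {p q : ι → M → ℝ} {R : κ → ι → M → ℝ} {y : κ → M → ℝ} {x : M}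
    (hη : ∀ᶠ z in 𝓝 x, ∀ v : Fin 1 → TangentSpace I z,
      η z v = ∑ b, p b z * (scalarDiff I (q b) z (v 0) -
        ∑ i, R i b z * scalarDiff I (y i) z (v 0)))
    (hp : ∀ b, ContMDiffAt I 𝓘(ℝ, ℝ) ∞ (p b) x) (hq : ∀ b, ContMDiffAt I 𝓘(ℝ, ℝ) ∞ (q b) x)
    (hR : ∀ i b, ContMDiffAt I 𝓘(ℝ, ℝ) ∞ (R i b) x) (hy : ∀ i, ContMDiffAt I 𝓘(ℝ, ℝ) ∞ (y i) x)
    (u v : TangentSpace I x) :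
    η.d x ![u, v] =
      ∑ b, (scalarDiff I (p b) x u *
          (scalarDiff I (q b) x v - ∑ i, R i b x * scalarDiff I (y i) x v) -
        scalarDiff I (p b) x v *
          (scalarDiff I (q b) x u - ∑ i, R i b x * scalarDiff I (y i) x u)) -
      ∑ b, p b x * ∑ i, (scalarDiff I (R i b) x u * scalarDiff I (y i) x v -
        scalarDiff I (R i b) x v * scalarDiff I (y i) x u) := by
  -- The index set ι ⊕ (ι × κ) separates the terms p_b dq_b from the terms −(p_b R_i^b) dy_i; the
  -- product rule then splits the latter.
  have h := Form.d_apply_of_eq_sum_mul_mfderiv (ι := ι ⊕ (ι × κ)) (η := η) (x := x)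
    (a := Sum.elim p fun j z => -(p j.1 z * R j.2 j.1 z)) (b := Sum.elim q fun j => y j.2)
    ?_ ?_ ?_ u v
  · rw [h, Fintype.sum_sum_type, Fintype.sum_prod_type]
    simp only [Sum.elim_inl, Sum.elim_inr, scalarDiff_neg, scalarDiff_mul (hp _) (hR _ _)]
    rw [← Finset.sum_add_distrib, ← Finset.sum_sub_distrib]
    refine Finset.sum_congr rfl fun b _ => ?_
    rw [mul_sub, mul_sub, Finset.mul_sum, Finset.mul_sum, Finset.mul_sum]
    have : ∀ x y p q s : ℝ, x - p - (y - q) - s = x - y + (q - p - s) := by intros; ring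
    rw [this, ← Finset.sum_sub_distrib, ← Finset.sum_sub_distrib]
    congr 1
    exact Finset.sum_congr rfl fun i _ => by ring
  · filter_upwards [hη] with z hz v
    rw [hz, Fintype.sum_sum_type, Fintype.sum_prod_type]
    simp only [Sum.elim_inl, Sum.elim_inr]
    rw [← Finset.sum_add_distrib]
    refine Finset.sum_congr rfl fun b _ => ?_
    rw [mul_sub, Finset.mul_sum, sub_eq_add_neg, ← Finset.sum_neg_distrib]
    congr 1
    exact Finset.sum_congr rfl fun i _ => by ring
  · rintro (b | ⟨b, i⟩)
    · exact hp b
    · exact ((hp b).mul (hR i b)).neg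
  · rintro (b | ⟨b, i⟩)
    · exact hq b
    · exact hy i

end ExteriorDerivative

namespace FoliationChart

/-! ### The frame (Y_i, ∂/∂q^a) of a foliation chart and its dual coframe. -/

section Pointwise

variable {k r : ℕ} {Y : Type*} [TopologicalSpace Y]
  [ChartedSpace (EuclideanSpace ℝ (Fin (2 * k + r))) Y] [IsManifold (𝓡 (2 * k + r)) ∞ Y]
  {Ω : Form (𝓡 (2 * k + r)) Y 2}
  (φ : FoliationChart Ω)

theorem mdifferentiable_chart : φ.chart.MDifferentiable (𝓡 (2 * k + r))
    𝓘(ℝ, EuclideanSpace ℝ (Fin (2 * k)) × EuclideanSpace ℝ (Fin r)) :=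
  ⟨φ.smooth.mdifferentiableOn (by simp), φ.smooth_symm.mdifferentiableOn (by simp)⟩

variable {φ} {y : Y}

theorem isInvertible_deriv (hy : y ∈ φ.chart.source) : (φ.deriv y).IsInvertible :=
  ⟨φ.mdifferentiable_chart.mfderiv hy, rfl⟩

theorem deriv_inverse (hy : y ∈ φ.chart.source)
    (w : EuclideanSpace ℝ (Fin (2 * k)) × EuclideanSpace ℝ (Fin r)) :
    φ.deriv y ((φ.deriv y).inverse w) = w :=
  (isInvertible_deriv hy).self_apply_inverse w

theorem deriv_injective (hy : y ∈ φ.chart.source) : Injective (φ.deriv y) :=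
  (isInvertible_deriv hy).injective

theorem deriv_dy (hy : y ∈ φ.chart.source) (i : Fin (2 * k)) :
    φ.deriv y (φ.dy i y) = (EuclideanSpace.single i 1, 0) :=
  deriv_inverse hy _

theorem deriv_dq (hy : y ∈ φ.chart.source) (a : Fin r) :
    φ.deriv y (φ.dq a y) = (0, EuclideanSpace.single a 1) :=
  deriv_inverse hy _

theorem mem_ker_iff_deriv (hy : y ∈ φ.chart.source) (v : TangentSpace (𝓡 (2 * k + r)) y) :
    v ∈ Ω.ker y ↔ (φ.deriv y v).1 = 0 :=
  φ.mem_ker_iff y hy v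

theorem dq_mem_ker (hy : y ∈ φ.chart.source) (a : Fin r) : φ.dq a y ∈ Ω.ker y := by
  rw [mem_ker_iff_deriv hy, deriv_dq hy]

variable [TopologicalSpace (TotalSpace (Fib r) (NullDist Ω))]
  [FiberBundle (Fib r) (NullDist Ω)] [VectorBundle ℝ (Fib r) (NullDist Ω)] {S : Splitting Ω}

theorem _root_.MasterEq.Splitting.proj_mem_ker (v : TangentSpace (𝓡 (2 * k + r)) y) :
    S.proj y v ∈ Ω.ker y :=
  (S.pG y v).2

theorem _root_.MasterEq.Splitting.proj_of_mem_ker {v : TangentSpace (𝓡 (2 * k + r)) y}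
    (hv : v ∈ Ω.ker y) : S.proj y v = v :=
  congrArg Subtype.val (S.pG_apply_coe y ⟨v, hv⟩)

theorem _root_.MasterEq.Splitting.proj_dq (hy : y ∈ φ.chart.source) (a : Fin r) :
    S.proj y (φ.dq a y) = φ.dq a y :=
  S.proj_of_mem_ker (dq_mem_ker hy a)

theorem qComp_apply (b : Fin r) (v : TangentSpace (𝓡 (2 * k + r)) y) :
    φ.qComp b y v = (φ.deriv y v).2 b := rfl

theorem eq_sum_dq_of_mem_ker (hy : y ∈ φ.chart.source) {v : TangentSpace (𝓡 (2 * k + r)) y}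
    (hv : v ∈ Ω.ker y) : v = ∑ b, φ.qComp b y v • φ.dq b y := by
  apply deriv_injective hy
  rw [map_sum]
  simp only [map_smul, deriv_dq hy]
  refine Prod.ext ?_ ?_
  · rw [(mem_ker_iff_deriv hy v).1 hv, Prod.fst_sum]
    simp
  · rw [Prod.snd_sum]
    ext c
    simp [qComp_apply, Pi.single_apply]

variable (φ S) in
/-- The coefficients `R_i^b` of the horizontal fields `Y_i = ∂/∂yⁱ + R_i^b ∂/∂q^b`. -/
def connCoeff (i : Fin (2 * k)) (b : Fin r) (y : Y) : ℝ :=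
  -φ.qComp b y (S.proj y (φ.dy i y))

theorem deriv_hor (hy : y ∈ φ.chart.source) (i : Fin (2 * k)) :
    φ.deriv y (φ.hor S i y) =
      (EuclideanSpace.single i 1, WithLp.toLp 2 fun b => φ.connCoeff S i b y) := by
  rw [hor, map_sub, deriv_dy hy]
  refine Prod.ext ?_ ?_
  · rw [Prod.fst_sub, (mem_ker_iff_deriv hy _).1 (S.proj_mem_ker _), sub_zero]
  · rw [Prod.snd_sub, zero_sub]
    rfl

theorem hor_eq_inverse (hy : y ∈ φ.chart.source) (i : Fin (2 * k)) :
    φ.hor S i y = (φ.deriv y).inverse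
      (EuclideanSpace.single i 1, WithLp.toLp 2 fun b => φ.connCoeff S i b y) := by
  apply deriv_injective hy
  rw [deriv_hor hy, deriv_inverse hy]

theorem eq_sum_dy_add_sum_dq (hy : y ∈ φ.chart.source) (v : TangentSpace (𝓡 (2 * k + r)) y) :
    v = ∑ i, (φ.deriv y v).1 i • φ.dy i y + ∑ b, (φ.deriv y v).2 b • φ.dq b y := by
  apply deriv_injective hy
  rw [map_add, map_sum, map_sum]
  simp only [map_smul, deriv_dq hy, deriv_dy hy]
  refine Prod.ext ?_ ?_
  · rw [Prod.fst_add, Prod.fst_sum, Prod.fst_sum]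
    ext c
    simp [Pi.single_apply]
  · rw [Prod.snd_add, Prod.snd_sum, Prod.snd_sum]
    ext c
    simp [Pi.single_apply]

/-- Π fixes ∂/∂q^b and sends ∂/∂yⁱ to −R_i^b ∂/∂q^b. This turns the invariant definition of f_b^*
into an expression in coordinate differentials that can be differentiated. -/
theorem fstar_apply (hy : y ∈ φ.chart.source) (b : Fin r) (v : TangentSpace (𝓡 (2 * k + r)) y) :
    φ.fstar S b y v = (φ.deriv y v).2 b - ∑ i, φ.connCoeff S i b y * (φ.deriv y v).1 i := by
  have h : φ.fstar S b y v = φ.qComp b y (S.proj y v) := rfl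
  rw [h]
  conv_lhs => rw [eq_sum_dy_add_sum_dq hy v]
  simp only [map_add, map_sum, map_smul, S.proj_dq hy, smul_eq_mul]
  simp only [qComp_apply, deriv_dq hy, connCoeff]
  rw [add_comm, sub_eq_add_neg, ← Finset.sum_neg_distrib]
  congr 1
  · simp
  · exact Finset.sum_congr rfl fun i _ => by ring

theorem fstar_dq (hy : y ∈ φ.chart.source) (b a : Fin r) :
    φ.fstar S b y (φ.dq a y) = if b = a then 1 else 0 := by
  rw [fstar_apply hy, deriv_dq hy]
  simp

theorem fstar_hor (hy : y ∈ φ.chart.source) (b : Fin r) (i : Fin (2 * k)) :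
    φ.fstar S b y (φ.hor S i y) = 0 := by
  rw [fstar_apply hy, deriv_hor hy]
  simp

theorem eq_sum_hor_add_sum_dq (hy : y ∈ φ.chart.source) (v : TangentSpace (𝓡 (2 * k + r)) y) :
    v = ∑ i, (φ.deriv y v).1 i • φ.hor S i y + ∑ b, φ.fstar S b y v • φ.dq b y := by
  apply deriv_injective hy
  rw [map_add, map_sum, map_sum]
  simp only [map_smul, deriv_dq hy, deriv_hor hy]
  refine Prod.ext ?_ ?_
  · rw [Prod.fst_add, Prod.fst_sum, Prod.fst_sum]
    ext c
    simp [Pi.single_apply]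
  · rw [Prod.snd_add, Prod.snd_sum, Prod.snd_sum]
    ext c
    simp [Pi.single_apply, fstar_apply hy, mul_comm]

/-- Kept in the fibre of E rather than in TY, so that a covector on E can be applied to it. -/
theorem pG_eq_sum (hy : y ∈ φ.chart.source) (v : TangentSpace (𝓡 (2 * k + r)) y) :
    S.pG y v = ∑ b, φ.fstar S b y v • S.pG y (φ.dq b y) := by
  apply Subtype.ext
  rw [Submodule.coe_sum]
  refine (eq_sum_dq_of_mem_ker hy (S.proj_mem_ker v)).trans (Finset.sum_congr rfl fun b _ => ?_)
  rw [Submodule.coe_smul]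
  exact congrArg _ (S.proj_dq hy b).symm

/-- Y_i and ∂/∂yⁱ differ by a vector of ker ω. -/
theorem Omega_hor (i j : Fin (2 * k)) :
    Ω y ![φ.hor S i y, φ.hor S j y] = φ.omegaComp i j y := by
  have h : ∀ u ∈ Ω.ker y, ∀ v, toBilin (Ω y) u v = 0 := fun u hu v => hu v trivial
  have h' : ∀ u ∈ Ω.ker y, ∀ v, toBilin (Ω y) v u = 0 := fun u hu v => by
    rw [toBilin_swap, h u hu, neg_zero]
  rw [← toBilin_apply, hor, hor, map_sub, map_sub, LinearMap.sub_apply,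
    h _ (S.proj_mem_ker _), LinearMap.sub_apply, h' _ (S.proj_mem_ker _),
    h _ (S.proj_mem_ker _)]
  simp [omegaComp]

end Pointwise

/-! ### Smoothness of the coordinate fields, of R_i^b and of p_b. -/

section Smoothness

variable {k r : ℕ} {Y : Type*} [TopologicalSpace Y]
  [ChartedSpace (EuclideanSpace ℝ (Fin (2 * k + r))) Y] [IsManifold (𝓡 (2 * k + r)) ∞ Y]
  {Ω : Form (𝓡 (2 * k + r)) Y 2}
  [TopologicalSpace (TotalSpace (Fib r) (NullDist Ω))]
  [FiberBundle (Fib r) (NullDist Ω)] [VectorBundle ℝ (Fib r) (NullDist Ω)]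
  [ContMDiffVectorBundle ∞ (Fib r) (NullDist Ω) (𝓡 (2 * k + r))]
  {S : Splitting Ω} {φ : FoliationChart Ω} {y : Y}

theorem contMDiffAt_chart (hy : y ∈ φ.chart.source) :
    ContMDiffAt (𝓡 (2 * k + r)) 𝓘(ℝ, EuclideanSpace ℝ (Fin (2 * k)) × EuclideanSpace ℝ (Fin r)) ∞
      φ.chart y :=
  φ.smooth.contMDiffAt (φ.chart.open_source.mem_nhds hy)

theorem contMDiffAt_chart_symm (hy : y ∈ φ.chart.source) :
    ContMDiffAt 𝓘(ℝ, EuclideanSpace ℝ (Fin (2 * k)) × EuclideanSpace ℝ (Fin r)) (𝓡 (2 * k + r)) ∞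
      φ.chart.symm (φ.chart y) :=
  φ.smooth_symm.contMDiffAt (φ.chart.open_target.mem_nhds (φ.chart.map_source hy))

/-- The field is the pullback of a constant field under the chart. -/
theorem contMDiffAt_inverse_const (hy : y ∈ φ.chart.source)
    (w : EuclideanSpace ℝ (Fin (2 * k)) × EuclideanSpace ℝ (Fin r)) :
    ContMDiffAt (𝓡 (2 * k + r)) (𝓡 (2 * k + r)).tangent ∞
      (fun y => (⟨y, (φ.deriv y).inverse w⟩ : TangentBundle (𝓡 (2 * k + r)) Y)) y := by
  have hV : ContMDiffAt 𝓘(ℝ, EuclideanSpace ℝ (Fin (2 * k)) × EuclideanSpace ℝ (Fin r))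
      𝓘(ℝ, EuclideanSpace ℝ (Fin (2 * k)) × EuclideanSpace ℝ (Fin r)).tangent ∞
      (fun z => (⟨z, w⟩ : TangentBundle
        𝓘(ℝ, EuclideanSpace ℝ (Fin (2 * k)) × EuclideanSpace ℝ (Fin r)) _)) (φ.chart y) :=
    contMDiffAt_vectorSpace_iff_contDiffAt.2 contDiffAt_const
  exact hV.mpullback_vectorField_preimage (contMDiffAt_chart hy) (isInvertible_deriv hy) (by simp)

/-- The coefficient `dq^b (V)` of a smooth vector field `V` is smooth. -/
theorem contMDiffAt_qComp (hy : y ∈ φ.chart.source) {V : (y : Y) → TangentSpace (𝓡 (2 * k + r)) y}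
    (hV : ContMDiffAt (𝓡 (2 * k + r)) (𝓡 (2 * k + r)).tangent ∞
      (fun y => (⟨y, V y⟩ : TangentBundle (𝓡 (2 * k + r)) Y)) y) (b : Fin r) :
    ContMDiffAt (𝓡 (2 * k + r)) 𝓘(ℝ, ℝ) ∞ (fun y => φ.qComp b y (V y)) y := by
  have h1 := φ.smooth.contMDiffOn_tangentMapWithin (m := ∞) (by simp)
    φ.chart.open_source.uniqueMDiffOn
  have h2 : π (EuclideanSpace ℝ (Fin (2 * k + r)))
      (TangentSpace (𝓡 (2 * k + r)) : Y → Type _) ⁻¹' φ.chart.source ∈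
      𝓝 (⟨y, V y⟩ : TangentBundle (𝓡 (2 * k + r)) Y) :=
    (φ.chart.open_source.preimage (FiberBundle.continuous_proj _ _)).mem_nhds hy
  have h3 := (contMDiff_snd_tangentBundle_modelSpace (n := ∞)
    (EuclideanSpace ℝ (Fin (2 * k)) × EuclideanSpace ℝ (Fin r))
    𝓘(ℝ, EuclideanSpace ℝ (Fin (2 * k)) × EuclideanSpace ℝ (Fin r))).contMDiffAt.comp y
    ((h1.contMDiffAt h2).comp y hV)
  have h4 := ((EuclideanSpace.proj b).comp (ContinuousLinearMap.snd ℝ (EuclideanSpace ℝ (Fin (2 * k)))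
    (EuclideanSpace ℝ (Fin r)))).contMDiff.contMDiffAt.comp y h3
  refine h4.congr_of_eventuallyEq ?_
  filter_upwards [φ.chart.open_source.mem_nhds hy] with z hz
  simp only [Function.comp, tangentMapWithin, mfderivWithin_of_isOpen φ.chart.open_source hz]
  rfl

theorem contMDiffAt_pG (S : Splitting Ω) {V : (y : Y) → TangentSpace (𝓡 (2 * k + r)) y}
    (hV : ContMDiffAt (𝓡 (2 * k + r)) (𝓡 (2 * k + r)).tangent ∞
      (fun y => (⟨y, V y⟩ : TangentBundle (𝓡 (2 * k + r)) Y)) y) :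
    ContMDiffAt (𝓡 (2 * k + r)) ((𝓡 (2 * k + r)).prod 𝓘(ℝ, Fib r)) ∞
      (fun y => TotalSpace.mk' (Fib r) (E := NullDist Ω) y (S.pG y (V y))) y :=
  (S.smooth_pG y).clm_bundle_apply hV

/-- The splitting gives a smooth section of E; `IsSubbundle` makes it a smooth vector field on Y, to
which dq^b applies. -/
theorem contMDiffAt_connCoeff (hE : IsSubbundle Ω) (hy : y ∈ φ.chart.source) (i : Fin (2 * k))
    (b : Fin r) : ContMDiffAt (𝓡 (2 * k + r)) 𝓘(ℝ, ℝ) ∞ (φ.connCoeff S i b) y := by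
  have h1 := contMDiffAt_pG S (contMDiffAt_inverse_const hy (EuclideanSpace.single i 1, 0))
  exact (contMDiffAt_qComp hy ((hE y).clm_bundle_apply h1) b).neg

/-- p_b is the pairing of the tautological covector on E* with the pulled-back smooth section
p_G(∂/∂q^b). -/
theorem contMDiffAt_pCoord {l : EDual Ω} (hl : l.proj ∈ φ.chart.source) (b : Fin r) :
    ContMDiffAt (IDual k r) 𝓘(ℝ, ℝ) ∞ (fun l : EDual Ω => φ.pCoord S l b) l := by
  have h1 := contMDiffAt_pG S (contMDiffAt_inverse_const hl (0, EuclideanSpace.single b 1))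
  have h2 : ContMDiffAt (IDual k r) (𝓡 (2 * k + r)) ∞ (fun l : EDual Ω => l.proj) l :=
    contMDiffAt_proj _
  have h3 : ContMDiffAt (IDual k r) ((𝓡 (2 * k + r)).prod 𝓘(ℝ, ℝ)) ∞ (fun l : EDual Ω =>
      TotalSpace.mk' ℝ (E := Bundle.Trivial Y ℝ) l.proj (φ.pCoord S l b)) l :=
    ContMDiffAt.clm_bundle_apply (F₁ := Fib r) (F₂ := ℝ) (E₂ := Bundle.Trivial Y ℝ)
      (b := fun l : EDual Ω => l.proj) (ϕ := fun l : EDual Ω => l.snd)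
      (contMDiffAt_id (x := l)) (h1.comp l h2)
  simpa using (contMDiffAt_totalSpace.1 h3).2

end Smoothness

end FoliationChart

/-! ### The curvature of the splitting in foliation coordinates. -/

theorem mlieBracket_eq_lieBracket {E : Type*} [NormedAddCommGroup E] [NormedSpace ℝ E]
    {V W : (x : E) → TangentSpace 𝓘(ℝ, E) x} (z : E) :
    VectorField.mlieBracket 𝓘(ℝ, E) V W z = VectorField.lieBracket ℝ V W z := by
  rw [← VectorField.mlieBracketWithin_univ, VectorField.mlieBracketWithin_eq_lieBracketWithin]
  exact congrFun (VectorField.lieBracketWithin_univ (V := V) (W := W)) z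

namespace FoliationChart

section Curvature

variable {k r : ℕ} {Y : Type*} [TopologicalSpace Y]
  [ChartedSpace (EuclideanSpace ℝ (Fin (2 * k + r))) Y] [IsManifold (𝓡 (2 * k + r)) ∞ Y]
  {Ω : Form (𝓡 (2 * k + r)) Y 2}
  [TopologicalSpace (TotalSpace (Fib r) (NullDist Ω))]
  [FiberBundle (Fib r) (NullDist Ω)] [VectorBundle ℝ (Fib r) (NullDist Ω)]
  [ContMDiffVectorBundle ∞ (Fib r) (NullDist Ω) (𝓡 (2 * k + r))]
  {S : Splitting Ω} {φ : FoliationChart Ω} {y : Y}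

theorem scalarDiff_eq_fderiv_comp_chart_symm (hy : y ∈ φ.chart.source) {c : Y → ℝ}
    (hc : ContMDiffAt (𝓡 (2 * k + r)) 𝓘(ℝ, ℝ) ∞ c y) (v : TangentSpace (𝓡 (2 * k + r)) y) :
    scalarDiff (𝓡 (2 * k + r)) c y v =
      fderiv ℝ (c ∘ φ.chart.symm) (φ.chart y) (φ.deriv y v) := by
  have hs : φ.chart.symm (φ.chart y) = y := φ.chart.left_inv hy
  have h1 : MDifferentiableAt 𝓘(ℝ, EuclideanSpace ℝ (Fin (2 * k)) × EuclideanSpace ℝ (Fin r))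
      𝓘(ℝ, ℝ) (c ∘ φ.chart.symm) (φ.chart y) := by
    refine ContMDiffAt.mdifferentiableAt (n := ∞) ?_ (by simp)
    exact ContMDiffAt.comp _ (by rwa [hs]) (contMDiffAt_chart_symm hy)
  have h2 := (contMDiffAt_chart hy).mdifferentiableAt (by simp)
  have h3 : (c ∘ φ.chart.symm) ∘ φ.chart =ᶠ[𝓝 y] c := by
    filter_upwards [φ.chart.open_source.mem_nhds hy] with z hz
    exact congrArg c (φ.chart.left_inv hz)
  have h4 : mfderiv (𝓡 (2 * k + r)) 𝓘(ℝ, ℝ) c y = (mfderiv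
      𝓘(ℝ, EuclideanSpace ℝ (Fin (2 * k)) × EuclideanSpace ℝ (Fin r)) 𝓘(ℝ, ℝ)
      (c ∘ φ.chart.symm) (φ.chart y)).comp (φ.deriv y) := by
    rw [← h3.mfderiv_eq]
    exact mfderiv_comp y h1 h2
  rw [scalarDiff, h4, mfderiv_eq_fderiv]
  rfl

variable (φ S) in
/-- The horizontal field `Y_i` in foliation coordinates. -/
def horModel (i : Fin (2 * k)) (z : EuclideanSpace ℝ (Fin (2 * k)) × EuclideanSpace ℝ (Fin r)) :
    EuclideanSpace ℝ (Fin (2 * k)) × EuclideanSpace ℝ (Fin r) :=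
  (EuclideanSpace.single i 1, WithLp.toLp 2 fun b => φ.connCoeff S i b (φ.chart.symm z))

theorem contDiffAt_horModel (hE : IsSubbundle Ω) (hy : y ∈ φ.chart.source) (i : Fin (2 * k)) :
    ContDiffAt ℝ ∞ (φ.horModel S i) (φ.chart y) := by
  refine contDiffAt_const.prodMk ?_
  rw [contDiffAt_euclidean]
  intro b
  rw [← contMDiffAt_iff_contDiffAt]
  have hs : φ.chart.symm (φ.chart y) = y := φ.chart.left_inv hy
  exact ContMDiffAt.comp (g := φ.connCoeff S i b) (f := φ.chart.symm) _
    (by rw [hs]; exact contMDiffAt_connCoeff hE hy i b) (contMDiffAt_chart_symm hy)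

theorem fderiv_horModel_fst (hE : IsSubbundle Ω) (hy : y ∈ φ.chart.source) (i : Fin (2 * k))
    (w : EuclideanSpace ℝ (Fin (2 * k)) × EuclideanSpace ℝ (Fin r)) :
    (fderiv ℝ (φ.horModel S i) (φ.chart y) w).1 = 0 := by
  have h := ((contDiffAt_horModel (S := S) hE hy i).differentiableAt (by simp)).hasFDerivAt.fst
  have h' : HasFDerivAt (fun z => (φ.horModel S i z).1) (0 : _ →L[ℝ] _) (φ.chart y) :=
    hasFDerivAt_const (EuclideanSpace.single i (1 : ℝ)) _
  exact DFunLike.congr_fun (h.unique h') w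

theorem fderiv_horModel_snd (hE : IsSubbundle Ω) (hy : y ∈ φ.chart.source) (i : Fin (2 * k))
    (b : Fin r) (v : TangentSpace (𝓡 (2 * k + r)) y) :
    (fderiv ℝ (φ.horModel S i) (φ.chart y) (φ.deriv y v)).2 b =
      scalarDiff (𝓡 (2 * k + r)) (φ.connCoeff S i b) y v := by
  have h := ((contDiffAt_horModel (S := S) hE hy i).differentiableAt (by simp)).hasFDerivAt.snd
  have h' := (EuclideanSpace.proj (𝕜 := ℝ) b).hasFDerivAt.comp _ h
  rw [scalarDiff_eq_fderiv_comp_chart_symm hy (contMDiffAt_connCoeff hE hy i b)]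
  exact (DFunLike.congr_fun h'.fderiv (φ.deriv y v)).symm

/-- `[Y_i, Y_j]` in foliation coordinates. -/
theorem deriv_mlieBracket_hor (hE : IsSubbundle Ω) (hy : y ∈ φ.chart.source) (i j : Fin (2 * k)) :
    φ.deriv y (VectorField.mlieBracket (𝓡 (2 * k + r)) (φ.hor S i) (φ.hor S j) y) =
      fderiv ℝ (φ.horModel S j) (φ.chart y) (φ.deriv y (φ.hor S i y)) -
        fderiv ℝ (φ.horModel S i) (φ.chart y) (φ.deriv y (φ.hor S j y)) := by
  have hmodel : ∀ i : Fin (2 * k), ∀ z ∈ φ.chart.source,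
      φ.horModel S i (φ.chart z) = φ.deriv z (φ.hor S i z) := fun i z hz => by
    rw [deriv_hor hz, horModel, φ.chart.left_inv hz]
  have hev : ∀ i : Fin (2 * k), φ.hor S i =ᶠ[𝓝 y] VectorField.mpullback (𝓡 (2 * k + r))
      𝓘(ℝ, EuclideanSpace ℝ (Fin (2 * k)) × EuclideanSpace ℝ (Fin r)) φ.chart
      (φ.horModel S i) := fun i => by
    filter_upwards [φ.chart.open_source.mem_nhds hy] with z hz
    rw [hor_eq_inverse hz, ← deriv_hor hz, ← hmodel i z hz]
    rfl
  have hdiff : ∀ i : Fin (2 * k), MDifferentiableAt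
      𝓘(ℝ, EuclideanSpace ℝ (Fin (2 * k)) × EuclideanSpace ℝ (Fin r))
      𝓘(ℝ, EuclideanSpace ℝ (Fin (2 * k)) × EuclideanSpace ℝ (Fin r)).tangent
      (fun z => (⟨z, φ.horModel S i z⟩ : TangentBundle
        𝓘(ℝ, EuclideanSpace ℝ (Fin (2 * k)) × EuclideanSpace ℝ (Fin r)) _)) (φ.chart y) :=
    fun i => (contMDiffAt_vectorSpace_iff_contDiffAt.2
      (contDiffAt_horModel hE hy i)).mdifferentiableAt (by simp)
  have : IsManifold (𝓡 (2 * k + r)) (minSmoothness ℝ 2) Y := 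
    IsManifold.of_le (n := ∞) (by simp; norm_cast)
  have : IsManifold (𝓡 (2 * k + r)) (minSmoothness ℝ 3) Y := 
    IsManifold.of_le (n := ∞) (by simp; norm_cast)
  -- Near y the Y_i are pullbacks of the model fields, and Lie brackets commute with pullback, so
  -- the bracket is computed in the vector space.
  rw [(hev i).mlieBracket_vectorField_eq (hev j),
    ← VectorField.mpullback_mlieBracket (n := ∞) (hdiff i) (hdiff j) (contMDiffAt_chart hy)
      (by simp; norm_cast)]
  refine (deriv_inverse hy _).trans ?_
  refine (mlieBracket_eq_lieBracket (V := φ.horModel S i) (W := φ.horModel S j) _).trans ?_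
  rw [← hmodel i y hy, ← hmodel j y hy]
  rfl

/-- The y-components of the Y_i are constant, so [Y_i, Y_j] lies in E and Π fixes it; its
q-components are derivatives of the R's. -/
theorem curv_eq (hE : IsSubbundle Ω) (hy : y ∈ φ.chart.source) (i j : Fin (2 * k)) (b : Fin r) :
    φ.curv S i j b y = scalarDiff (𝓡 (2 * k + r)) (φ.connCoeff S j b) y (φ.hor S i y) -
      scalarDiff (𝓡 (2 * k + r)) (φ.connCoeff S i b) y (φ.hor S j y) := by
  have h := deriv_mlieBracket_hor (S := S) hE hy i j
  rw [curv, S.proj_of_mem_ker, qComp_apply, h, Prod.snd_sub, PiLp.sub_apply,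
    fderiv_horModel_snd hE hy, fderiv_horModel_snd hE hy]
  rw [mem_ker_iff_deriv hy, h, Prod.fst_sub, fderiv_horModel_fst hE hy,
    fderiv_horModel_fst hE hy, sub_zero]

end Curvature

end FoliationChart

/-! ### The forms θ_G and ω_U in the canonical coordinates (y, q, p). -/

theorem mfderiv_clm_comp {V H : Type*} [NormedAddCommGroup V] [NormedSpace ℝ V]
    [TopologicalSpace H] {I : ModelWithCorners ℝ V H} {M : Type*} [TopologicalSpace M]
    [ChartedSpace H M] {F F' : Type*} [NormedAddCommGroup F] [NormedSpace ℝ F]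
    [NormedAddCommGroup F'] [NormedSpace ℝ F'] {f : M → F} {x : M}
    (hf : MDifferentiableAt I 𝓘(ℝ, F) f x) (c : F →L[ℝ] F') (v : TangentSpace I x) :
    mfderiv I 𝓘(ℝ, F') (fun z => c (f z)) x v = c (mfderiv I 𝓘(ℝ, F) f x v) := by
  have h := mfderiv_comp (I'' := 𝓘(ℝ, F')) (g := c) (f := f) x c.mdifferentiableAt hf
  refine (DFunLike.congr_fun h v).trans ?_
  rw [c.mfderiv_eq]
  rfl

namespace FoliationChart

section SymplecticForm

variable {k r : ℕ} {Y : Type*} [TopologicalSpace Y]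
  [ChartedSpace (EuclideanSpace ℝ (Fin (2 * k + r))) Y] [IsManifold (𝓡 (2 * k + r)) ∞ Y]
  {Ω : Form (𝓡 (2 * k + r)) Y 2}
  [TopologicalSpace (TotalSpace (Fib r) (NullDist Ω))]
  [FiberBundle (Fib r) (NullDist Ω)] [VectorBundle ℝ (Fib r) (NullDist Ω)]
  [ContMDiffVectorBundle ∞ (Fib r) (NullDist Ω) (𝓡 (2 * k + r))]
  {S : Splitting Ω} {φ : FoliationChart Ω} {l : EDual Ω}

theorem contMDiffAt_base (l : EDual Ω) :
    ContMDiffAt (IDual k r) (𝓡 (2 * k + r)) ∞ (fun l : EDual Ω => l.proj) l :=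
  contMDiffAt_proj _

theorem scalarDiff_comp_proj {c : Y → ℝ} (hc : ContMDiffAt (𝓡 (2 * k + r)) 𝓘(ℝ, ℝ) ∞ c l.proj)
    (u : TangentSpace (IDual k r) l) :
    scalarDiff (IDual k r) (fun l : EDual Ω => c l.proj) l u =
      scalarDiff (𝓡 (2 * k + r)) c l.proj (dπ l u) := by
  have h := mfderiv_comp (g := c) (f := fun l : EDual Ω => l.proj) l
    (hc.mdifferentiableAt (by simp)) ((contMDiffAt_base l).mdifferentiableAt (by simp))
  exact DFunLike.congr_fun h u

theorem contMDiffAt_yCoord {y : Y} (hy : y ∈ φ.chart.source) (i : Fin (2 * k)) :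
    ContMDiffAt (𝓡 (2 * k + r)) 𝓘(ℝ, ℝ) ∞ (fun y => (φ.chart y).1 i) y :=
  ((EuclideanSpace.proj i).comp (ContinuousLinearMap.fst ℝ (EuclideanSpace ℝ (Fin (2 * k)))
    (EuclideanSpace ℝ (Fin r)))).contMDiff.contMDiffAt.comp y (contMDiffAt_chart hy)

theorem contMDiffAt_qCoord {y : Y} (hy : y ∈ φ.chart.source) (b : Fin r) :
    ContMDiffAt (𝓡 (2 * k + r)) 𝓘(ℝ, ℝ) ∞ (fun y => (φ.chart y).2 b) y :=
  ((EuclideanSpace.proj b).comp (ContinuousLinearMap.snd ℝ (EuclideanSpace ℝ (Fin (2 * k)))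
    (EuclideanSpace ℝ (Fin r)))).contMDiff.contMDiffAt.comp y (contMDiffAt_chart hy)

theorem scalarDiff_clm_comp_chart {y : Y} (hy : y ∈ φ.chart.source)
    (c : EuclideanSpace ℝ (Fin (2 * k)) × EuclideanSpace ℝ (Fin r) →L[ℝ] ℝ)
    (v : TangentSpace (𝓡 (2 * k + r)) y) :
    scalarDiff (𝓡 (2 * k + r)) (fun y => c (φ.chart y)) y v = c (φ.deriv y v) := by
  exact mfderiv_clm_comp ((contMDiffAt_chart hy).mdifferentiableAt (by simp)) c v

theorem scalarDiff_yCoord {y : Y} (hy : y ∈ φ.chart.source) (i : Fin (2 * k))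
    (v : TangentSpace (𝓡 (2 * k + r)) y) :
    scalarDiff (𝓡 (2 * k + r)) (fun y => (φ.chart y).1 i) y v = (φ.deriv y v).1 i :=
  scalarDiff_clm_comp_chart hy ((EuclideanSpace.proj i).comp (ContinuousLinearMap.fst ℝ _ _)) v

theorem scalarDiff_qCoord {y : Y} (hy : y ∈ φ.chart.source) (b : Fin r)
    (v : TangentSpace (𝓡 (2 * k + r)) y) :
    scalarDiff (𝓡 (2 * k + r)) (fun y => (φ.chart y).2 b) y v = (φ.deriv y v).2 b :=
  scalarDiff_clm_comp_chart hy ((EuclideanSpace.proj b).comp (ContinuousLinearMap.snd ℝ _ _)) v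

variable (φ S) in
/-- The covector `dp_b` on `E*`. -/
def dp (b : Fin r) (l : EDual Ω) : TangentSpace (IDual k r) l →L[ℝ] ℝ :=
  scalarDiff (IDual k r) (fun l : EDual Ω => φ.pCoord S l b) l

theorem coordDeriv_apply (hl : l.proj ∈ φ.chart.source) (u : TangentSpace (IDual k r) l) :
    φ.coordDeriv S l u =
      (φ.deriv l.proj (dπ l u), WithLp.toLp 2 fun b => φ.dp S b l u) := by
  have h1 : MDifferentiableAt (IDual k r)
      𝓘(ℝ, EuclideanSpace ℝ (Fin (2 * k)) × EuclideanSpace ℝ (Fin r))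
      (fun l : EDual Ω => φ.chart l.proj) l :=
    ((contMDiffAt_chart hl).comp l (contMDiffAt_base l)).mdifferentiableAt (by simp)
  have h2 : MDifferentiableAt (IDual k r) 𝓘(ℝ, EuclideanSpace ℝ (Fin r))
      (fun l : EDual Ω => WithLp.toLp 2 (φ.pCoord S l)) l := by
    have h : ContMDiffAt (IDual k r) 𝓘(ℝ, Fin r → ℝ) ∞ (φ.pCoord S) l :=
      contMDiffAt_pi_space.2 fun b => contMDiffAt_pCoord hl b
    exact ((EuclideanSpace.equiv (Fin r) ℝ).symm.toContinuousLinearMap.contMDiff.contMDiffAt.comp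
      l h).mdifferentiableAt (by simp)
  have h3 : MDifferentiableAt (IDual k r) 𝓘(ℝ, (EuclideanSpace ℝ (Fin (2 * k)) ×
      EuclideanSpace ℝ (Fin r)) × EuclideanSpace ℝ (Fin r)) (φ.coord S) l :=
    h1.prodMk_space h2
  refine Prod.ext ?_ ?_
  · refine (mfderiv_clm_comp h3 (ContinuousLinearMap.fst ℝ _ _) u).symm.trans ?_
    exact DFunLike.congr_fun (mfderiv_comp (g := φ.chart) (f := fun l : EDual Ω => l.proj) l
      ((contMDiffAt_chart hl).mdifferentiableAt (by simp))
      ((contMDiffAt_base l).mdifferentiableAt (by simp))) u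
  · ext b
    exact (mfderiv_clm_comp h3 ((EuclideanSpace.proj b).comp (ContinuousLinearMap.snd ℝ _ _))
      u).symm

theorem theta_apply (hl : l.proj ∈ φ.chart.source) (v : Fin 1 → TangentSpace (IDual k r) l) :
    S.theta l v = ∑ b, φ.pCoord S l b * φ.fstar S b l.proj (dπ l (v 0)) := by
  have h : S.theta l v = l.snd (S.pG l.proj (dπ l (v 0))) := rfl
  rw [h, pG_eq_sum hl, map_sum]
  refine Finset.sum_congr rfl fun b _ => ?_
  rw [map_smul, smul_eq_mul, mul_comm]
  rfl

/-- This is d(p_b f_b^*). The second sum comes from df_b^* = −dR_i^b ∧ dyⁱ and is the source of the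
curvature term in ω̃. -/
theorem theta_d_apply (hE : IsSubbundle Ω) (hl : l.proj ∈ φ.chart.source)
    (u v : TangentSpace (IDual k r) l) :
    S.theta.d l ![u, v] =
      ∑ b, (φ.dp S b l u * φ.fstar S b l.proj (dπ l v) -
        φ.dp S b l v * φ.fstar S b l.proj (dπ l u)) -
      ∑ b, φ.pCoord S l b * ∑ i,
        (scalarDiff (𝓡 (2 * k + r)) (φ.connCoeff S i b) l.proj (dπ l u) *
            (φ.deriv l.proj (dπ l v)).1 i -
          scalarDiff (𝓡 (2 * k + r)) (φ.connCoeff S i b) l.proj (dπ l v) *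
            (φ.deriv l.proj (dπ l u)).1 i) := by
  have hsrc : ∀ᶠ z : EDual Ω in 𝓝 l, z.proj ∈ φ.chart.source :=
    (contMDiffAt_base l).continuousAt.eventually (φ.chart.open_source.mem_nhds hl)
  have h := Form.d_apply_of_eq_sum_mul_sub (η := S.theta) (x := l)
    (p := fun b z => φ.pCoord S z b) (q := fun b z => (φ.chart z.proj).2 b)
    (R := fun i b z => φ.connCoeff S i b z.proj) (y := fun i z => (φ.chart z.proj).1 i)
    ?_ (fun b => contMDiffAt_pCoord hl b)
    (fun b => (contMDiffAt_qCoord hl b).comp l (contMDiffAt_base l))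
    (fun i b => (contMDiffAt_connCoeff hE hl i b).comp l (contMDiffAt_base l))
    (fun i => (contMDiffAt_yCoord hl i).comp l (contMDiffAt_base l)) u v
  · simp only [scalarDiff_comp_proj (contMDiffAt_qCoord hl _), scalarDiff_qCoord hl,
      scalarDiff_comp_proj (contMDiffAt_yCoord hl _), scalarDiff_yCoord hl,
      scalarDiff_comp_proj (contMDiffAt_connCoeff hE hl _ _), ← fstar_apply hl] at h
    exact h
  · filter_upwards [hsrc] with z hz v
    rw [theta_apply hz]
    simp only [scalarDiff_comp_proj (contMDiffAt_qCoord hz _), scalarDiff_qCoord hz,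
      scalarDiff_comp_proj (contMDiffAt_yCoord hz _), scalarDiff_yCoord hz, ← fstar_apply hz]

variable (φ) in
/-- The covector `dyⁱ`. -/
def yComp (i : Fin (2 * k)) (y : Y) : TangentSpace (𝓡 (2 * k + r)) y →ₗ[ℝ] ℝ where
  toFun v := (φ.deriv y v).1 i
  map_add' := by simp
  map_smul' := by simp

variable (φ S) in
/-- The two-form `ω + p_b dR_i^b ∧ dyⁱ` on `T_{π(l)} Y`, whose components along the fields `Y_i`
are `ω_ij + p_b F^b_ij`. -/
def baseForm (l : EDual Ω) : TangentSpace (𝓡 (2 * k + r)) l.proj →ₗ[ℝ]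
    TangentSpace (𝓡 (2 * k + r)) l.proj →ₗ[ℝ] ℝ :=
  toBilin (Ω l.proj) + ∑ b, φ.pCoord S l b • ∑ i,
    wedge (scalarDiff (𝓡 (2 * k + r)) (φ.connCoeff S i b) l.proj).toLinearMap (φ.yComp i l.proj)

theorem baseForm_apply (u v : TangentSpace (𝓡 (2 * k + r)) l.proj) :
    φ.baseForm S l u v = Ω l.proj ![u, v] + ∑ b, φ.pCoord S l b * ∑ i,
      (scalarDiff (𝓡 (2 * k + r)) (φ.connCoeff S i b) l.proj u * (φ.deriv l.proj v).1 i -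
        scalarDiff (𝓡 (2 * k + r)) (φ.connCoeff S i b) l.proj v * (φ.deriv l.proj u).1 i) := by
  simp [baseForm, wedge, LinearMap.sum_apply, yComp, mul_comm]

theorem baseForm_swap (u v : TangentSpace (𝓡 (2 * k + r)) l.proj) :
    φ.baseForm S l u v = -φ.baseForm S l v u := by
  rw [baseForm_apply, baseForm_apply, ← toBilin_apply, toBilin_swap, neg_add, toBilin_apply,
    ← Finset.sum_neg_distrib]
  congr 1
  refine Finset.sum_congr rfl fun b _ => ?_
  rw [← mul_neg, ← Finset.sum_neg_distrib]
  congr 1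
  exact Finset.sum_congr rfl fun i _ => by ring

theorem baseForm_dq (hl : l.proj ∈ φ.chart.source) (a b : Fin r) :
    φ.baseForm S l (φ.dq a l.proj) (φ.dq b l.proj) = 0 := by
  rw [baseForm_apply, deriv_dq hl, deriv_dq hl, dq_mem_ker hl a _ trivial]
  simp

/-- Since dy^m(Y_j) = δ^m_j, the form dR_m^b ∧ dy^m takes the value Y_i R_j^b − Y_j R_i^b on (Y_i,
Y_j), which is the curvature by `curv_eq`. -/
theorem baseForm_hor (hE : IsSubbundle Ω) (hl : l.proj ∈ φ.chart.source) (i j : Fin (2 * k)) :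
    φ.baseForm S l (φ.hor S i l.proj) (φ.hor S j l.proj) =
      φ.omegaComp i j l.proj + ∑ b, φ.pCoord S l b * φ.curv S i j b l.proj := by
  rw [baseForm_apply, Omega_hor, deriv_hor hl, deriv_hor hl]
  congr 1
  refine Finset.sum_congr rfl fun b _ => ?_
  rw [curv_eq hE hl]
  simp [Finset.sum_sub_distrib]

/-- The local normal form of ω_U: a form from the base minus dp_b ∧ f_b^*. The linear algebra below
sees ω_U only through this formula, antisymmetry and non-degeneracy. -/
theorem omega_apply (hE : IsSubbundle Ω) (hl : l.proj ∈ φ.chart.source)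
    (u v : TangentSpace (IDual k r) l) :
    S.omega l ![u, v] = φ.baseForm S l (dπ l u) (dπ l v) -
      ∑ b, (φ.dp S b l u * φ.fstar S b l.proj (dπ l v) -
        φ.dp S b l v * φ.fstar S b l.proj (dπ l u)) := by
  have e : dπ l ∘ ![u, v] = ![dπ l u, dπ l v] := by
    ext i; fin_cases i <;> rfl
  have h : S.omega l ![u, v] = Ω l.proj (dπ l ∘ ![u, v]) - S.theta.d l ![u, v] := rfl
  rw [e] at h
  refine (h.trans (congrArg _ (theta_d_apply hE hl u v))).trans ?_
  rw [baseForm_apply]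
  ring

end SymplecticForm

end FoliationChart

/-! ### Orthogonals of subspaces in an adapted frame. -/

section LinearAlgebra

open Matrix

variable {T ι κ : Type*} [AddCommGroup T] [Module ℝ T] [Fintype ι] [Fintype κ] [DecidableEq ι]
  [DecidableEq κ]

/-- A frame `(e, E, P)` of a vector space with an alternating form, such that `E` and `P` are dual
isotropic families, orthogonal to the family `e`, whose Gram matrix is `W`. -/
structure AdaptedFrame (B : T →ₗ[ℝ] T →ₗ[ℝ] ℝ) (e : ι → T) (E P : κ → T) (W : Matrix ι ι ℝ) :
    Prop where
  swap : ∀ u v, B u v = -B v u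
  e_e : ∀ i j, B (e i) (e j) = W i j
  e_E : ∀ i a, B (e i) (E a) = 0
  e_P : ∀ i a, B (e i) (P a) = 0
  E_E : ∀ a b, B (E a) (E b) = 0
  E_P : ∀ a b, B (E a) (P b) = if a = b then 1 else 0
  P_P : ∀ a b, B (P a) (P b) = 0
  exists_eq : ∀ u, ∃ h x y, u = Fintype.linearCombination ℝ e h + Fintype.linearCombination ℝ E x +
    Fintype.linearCombination ℝ P y

namespace AdaptedFrame

variable {B : T →ₗ[ℝ] T →ₗ[ℝ] ℝ} {e : ι → T} {E P : κ → T} {W : Matrix ι ι ℝ}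

/-- The vector with components `(h, x, y)` in the frame `(e, E, P)`. -/
def comb (e : ι → T) (E P : κ → T) (h : ι → ℝ) (x y : κ → ℝ) : T :=
  Fintype.linearCombination ℝ e h + Fintype.linearCombination ℝ E x +
    Fintype.linearCombination ℝ P y

/-- Pairing with e, E and P reads off Wᵀh, −y and x respectively; the transpose appears because the
combination occupies the first slot. -/
theorem comb_e (F : AdaptedFrame B e E P W) (h : ι → ℝ) (x y : κ → ℝ) (j : ι) :
    B (comb e E P h x y) (e j) = (Wᵀ *ᵥ h) j := by
  have h1 : ∀ a, B (E a) (e j) = 0 := fun a => by rw [F.swap, F.e_E, neg_zero]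
  have h2 : ∀ a, B (P a) (e j) = 0 := fun a => by rw [F.swap, F.e_P, neg_zero]
  simp [comb, Fintype.linearCombination_apply, LinearMap.sum_apply, F.e_e, h1, h2, mulVec,
    dotProduct, mul_comm]

theorem comb_E (F : AdaptedFrame B e E P W) (h : ι → ℝ) (x y : κ → ℝ) (b : κ) : B (comb e E P h x y) (E b) = -y b := by
  have h2 : ∀ a, B (P a) (E b) = -if b = a then 1 else 0 := fun a => by rw [F.swap, F.E_P]
  simp [comb, Fintype.linearCombination_apply, LinearMap.sum_apply, F.e_E, F.E_E, h2]

theorem comb_P (F : AdaptedFrame B e E P W) (h : ι → ℝ) (x y : κ → ℝ) (b : κ) : B (comb e E P h x y) (P b) = x b := by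
  simp [comb, Fintype.linearCombination_apply, LinearMap.sum_apply, F.e_P, F.E_P, F.P_P]

theorem eq_zero_of_forall (F : AdaptedFrame B e E P W) {u : T} (h_nd : ∀ u, (∀ v, B u v = 0) → u = 0)
    (he : ∀ i, B u (e i) = 0) (hE : ∀ a, B u (E a) = 0) (hP : ∀ a, B u (P a) = 0) : u = 0 := by
  refine h_nd u fun v => ?_
  obtain ⟨h, x, y, rfl⟩ := F.exists_eq v
  simp [Fintype.linearCombination_apply, he, hE, hP]

/-- The Gram matrix is invertible if the form is non-degenerate. -/
theorem isUnit (F : AdaptedFrame B e E P W) (h_nd : ∀ u, (∀ v, B u v = 0) → u = 0) (he : LinearIndependent ℝ e) : IsUnit W := by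
  rw [← isUnit_transpose, ← mulVec_injective_iff_isUnit]
  refine (injective_iff_map_eq_zero (Wᵀ.mulVecLin)).2 fun h hh => ?_
  -- A vector h in the kernel of Wᵀ gives a combination ∑ h_i e_i orthogonal to the whole frame.
  have h0 : comb e E P h (0 : κ → ℝ) 0 = 0 := F.eq_zero_of_forall h_nd
    (fun i => by rw [F.comb_e]; exact congrFun hh i) (fun a => by rw [F.comb_E]; simp)
    (fun a => by rw [F.comb_P]; simp)
  have h1 : ∑ i, h i • e i = 0 := by
    simpa [comb, Fintype.linearCombination_apply] using h0
  exact funext (Fintype.linearIndependent_iff.1 he h h1)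

/-- Coordinates are recovered from pairings with the frame, so their uniqueness needs only that W be
invertible. -/
theorem comb_injective (F : AdaptedFrame B e E P W) (hW : IsUnit W) {h h' : ι → ℝ} {x x' y y' : κ → ℝ}
    (H : comb e E P h x y = comb e E P h' x' y') : h = h' ∧ x = x' ∧ y = y' := by
  refine ⟨?_, ?_, ?_⟩
  · have hW' : Injective (Wᵀ.mulVec) := mulVec_injective_iff_isUnit.2 ((isUnit_transpose W).2 hW)
    refine hW' (funext fun i => ?_)
    rw [← F.comb_e h x y, H, F.comb_e]
  · ext b
    rw [← F.comb_P h x y, H, F.comb_P]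
  · ext b
    rw [← neg_inj, ← F.comb_E h x y, H, F.comb_E]

variable {N : Matrix ι κ ℝ} {M : Matrix κ κ ℝ} {L L' : Submodule ℝ T}

/-- The orthogonal of the subspace spanned by `e_i + N_ia P_a` and `E_b + M_ba P_a`. -/
theorem comb_mem_orth_iff (F : AdaptedFrame B e E P W) 
    (hL : ∀ u, u ∈ L ↔ ∃ h x, u = comb e E P h x (Nᵀ *ᵥ h + Mᵀ *ᵥ x))
    (hL' : ∀ u, u ∈ L' ↔ ∀ w ∈ L, B u w = 0) (h : ι → ℝ) (x y : κ → ℝ) :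
    comb e E P h x y ∈ L' ↔ Wᵀ *ᵥ h = -(N *ᵥ x) ∧ y = M *ᵥ x := by
  -- The pairing with a general vector of L is linear in the free parameters (h', x'); the two
  -- coefficient vectors must vanish separately.
  have key : ∀ h' x', B (comb e E P h x y) (comb e E P h' x' (Nᵀ *ᵥ h' + Mᵀ *ᵥ x')) =
      (Wᵀ *ᵥ h + N *ᵥ x) ⬝ᵥ h' + (M *ᵥ x - y) ⬝ᵥ x' := by
    intro h' x'
    have h1 : B (comb e E P h x y) (comb e E P h' x' (Nᵀ *ᵥ h' + Mᵀ *ᵥ x')) =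
        h' ⬝ᵥ (Wᵀ *ᵥ h) - x' ⬝ᵥ y + (Nᵀ *ᵥ h' + Mᵀ *ᵥ x') ⬝ᵥ x := by
      conv_lhs => rw [comb.eq_def e E P h' x']
      simp only [map_add, Fintype.linearCombination_apply, map_sum, map_smul, F.comb_e, F.comb_E,
        F.comb_P, smul_eq_mul]
      simp [dotProduct, sub_eq_add_neg, add_mul, Finset.sum_add_distrib]
    rw [h1, add_dotProduct, add_dotProduct, sub_dotProduct, mulVec_transpose N, mulVec_transpose M,
      ← dotProduct_mulVec, ← dotProduct_mulVec, dotProduct_comm h' (Wᵀ *ᵥ h),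
      dotProduct_comm h' (N *ᵥ x), dotProduct_comm x' y, dotProduct_comm x' (M *ᵥ x)]
    ring
  rw [hL']
  constructor
  · intro H
    have H' : ∀ h' x', (Wᵀ *ᵥ h + N *ᵥ x) ⬝ᵥ h' + (M *ᵥ x - y) ⬝ᵥ x' = 0 := fun h' x' => by
      rw [← key]
      exact H _ ((hL _).2 ⟨h', x', rfl⟩)
    constructor
    · refine eq_neg_of_add_eq_zero_left (dotProduct_eq_zero _ fun w => ?_)
      simpa using H' w 0
    · refine (sub_eq_zero.1 (dotProduct_eq_zero _ fun w => ?_)).symm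
      simpa using H' 0 w
  · rintro ⟨h1, h2⟩ w hw
    obtain ⟨h', x', rfl⟩ := (hL w).1 hw
    rw [key, h1, h2]
    simp

/-- Solving Wᵀh = −Nx for h leaves x as the only free parameter of the orthogonal. -/
theorem mem_orth_iff (F : AdaptedFrame B e E P W) (hW : IsUnit W)
    (hL : ∀ u, u ∈ L ↔ ∃ h x, u = comb e E P h x (Nᵀ *ᵥ h + Mᵀ *ᵥ x))
    (hL' : ∀ u, u ∈ L' ↔ ∀ w ∈ L, B u w = 0) (u : T) :
    u ∈ L' ↔ ∃ x, u = comb e E P (-((W⁻¹)ᵀ *ᵥ (N *ᵥ x))) x (M *ᵥ x) := by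
  have hdet : IsUnit W.det := (isUnit_iff_isUnit_det W).1 hW
  have h1 : Wᵀ * (W⁻¹)ᵀ = 1 := by rw [← transpose_mul, nonsing_inv_mul _ hdet, transpose_one]
  have h2 : (W⁻¹)ᵀ * Wᵀ = 1 := by rw [← transpose_mul, mul_nonsing_inv _ hdet, transpose_one]
  constructor
  · intro hu
    obtain ⟨h, x, y, rfl⟩ := F.exists_eq u
    obtain ⟨h3, h4⟩ := (F.comb_mem_orth_iff hL hL' h x y).1 hu
    refine ⟨x, ?_⟩
    have h5 : h = -((W⁻¹)ᵀ *ᵥ (N *ᵥ x)) := by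
      rw [← mulVec_neg, ← h3, mulVec_mulVec, h2, one_mulVec]
    rw [← h5, ← h4]
    rfl
  · rintro ⟨x, rfl⟩
    refine (F.comb_mem_orth_iff hL hL' _ _ _).2 ⟨?_, rfl⟩
    rw [mulVec_neg, mulVec_mulVec, h1, one_mulVec]

/-- The vector of L' with parameter x lies in L exactly when Mx = Nᵀh + Mᵀx for h = −W⁻ᵀNx; this for
all x is the matrix identity. -/
theorem orth_le_iff (F : AdaptedFrame B e E P W) (hW : IsUnit W)
    (hL : ∀ u, u ∈ L ↔ ∃ h x, u = comb e E P h x (Nᵀ *ᵥ h + Mᵀ *ᵥ x))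
    (hL' : ∀ u, u ∈ L' ↔ ∀ w ∈ L, B u w = 0) :
    L' ≤ L ↔ Nᵀ * (W⁻¹)ᵀ * N = Mᵀ - M := by
  have h1 : L' ≤ L ↔ ∀ x, (Mᵀ - M) *ᵥ x = (Nᵀ * (W⁻¹)ᵀ * N) *ᵥ x := by
    constructor
    · intro H x
      obtain ⟨h', x', hx⟩ := (hL _).1 (H ((F.mem_orth_iff hW hL hL' _).2 ⟨x, rfl⟩))
      obtain ⟨rfl, rfl, h3⟩ := F.comb_injective hW hx
      rw [sub_mulVec, h3, mulVec_neg, mulVec_mulVec, mulVec_mulVec]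
      abel
    · intro H u hu
      obtain ⟨x, rfl⟩ := (F.mem_orth_iff hW hL hL' u).1 hu
      refine (hL _).2 ⟨_, x, congrArg _ ?_⟩
      rw [mulVec_neg, mulVec_mulVec, mulVec_mulVec, ← H, sub_mulVec]
      abel
  rw [h1]
  exact ⟨fun H => (ext_of_mulVec_single fun i => H _).symm, fun H x => by rw [H]⟩

/-- The parametrisation by x is injective because x is itself a coordinate of the vector. Coisotropy
plays no role. -/
theorem finrank_orth (F : AdaptedFrame B e E P W) (hW : IsUnit W)
    (hL : ∀ u, u ∈ L ↔ ∃ h x, u = comb e E P h x (Nᵀ *ᵥ h + Mᵀ *ᵥ x))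
    (hL' : ∀ u, u ∈ L' ↔ ∀ w ∈ L, B u w = 0) : Module.finrank ℝ L' = Fintype.card κ := by
  let Φ : (κ → ℝ) →ₗ[ℝ] T := Fintype.linearCombination ℝ e ∘ₗ (-((W⁻¹)ᵀ * N).mulVecLin) +
    Fintype.linearCombination ℝ E + Fintype.linearCombination ℝ P ∘ₗ M.mulVecLin
  have hΦ : ∀ x, Φ x = comb e E P (-((W⁻¹)ᵀ *ᵥ (N *ᵥ x))) x (M *ᵥ x) := fun x => by
    rw [mulVec_mulVec]
    rfl
  have hr : L' = LinearMap.range Φ := by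
    ext u
    rw [F.mem_orth_iff hW hL hL', LinearMap.mem_range]
    exact exists_congr fun x => by rw [hΦ]; exact eq_comm
  have hi : Injective Φ := fun x x' H => by
    rw [hΦ, hΦ] at H
    exact (F.comb_injective hW H).2.1
  rw [hr, LinearMap.finrank_range_of_inj hi, Module.finrank_fintype_fun_eq_card]

end AdaptedFrame

end LinearAlgebra

/-! ### The pointwise model of a thickening and its adapted frame. -/

section Model

open Matrix

variable {T V ι κ : Type*} [AddCommGroup T] [Module ℝ T] [AddCommGroup V] [Module ℝ V] [Fintype ι]
  [Fintype κ] [DecidableEq ι] [DecidableEq κ]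

/-- The pointwise linear algebra of a thickening: `D : T → V` is the derivative of the projection,
`p_b` are the differentials of the fibre coordinates, `(Z_i, Q_a)` is a frame of `V` with dual
coframe `(η_i, f_a)`, and `B` is the twisted form on the base. -/
structure ThickeningModel (σ : T →ₗ[ℝ] T →ₗ[ℝ] ℝ) (D : T →ₗ[ℝ] V) (p : κ → T →ₗ[ℝ] ℝ)
    (B : V →ₗ[ℝ] V →ₗ[ℝ] ℝ) (Z : ι → V) (Q : κ → V) (η : ι → V →ₗ[ℝ] ℝ) (f : κ → V →ₗ[ℝ] ℝ) :
    Prop where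
  eq_sum : ∀ v, v = ∑ i, η i v • Z i + ∑ b, f b v • Q b
  f_Q : ∀ b a, f b (Q a) = if b = a then 1 else 0
  f_Z : ∀ b i, f b (Z i) = 0
  η_Q : ∀ i a, η i (Q a) = 0
  η_Z : ∀ i j, η i (Z j) = if i = j then 1 else 0
  B_swap : ∀ u v, B u v = -B v u
  B_Q : ∀ a b, B (Q a) (Q b) = 0
  swap : ∀ u v, σ u v = -σ v u
  apply_eq : ∀ u v, σ u v = B (D u) (D v) - ∑ b, (p b u * f b (D v) - p b v * f b (D u))
  nondegenerate : ∀ u, (∀ v, σ u v = 0) → u = 0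

/-- The frame `(e_i, E_a, P_a)` of `T` associated with the frame `(Z_i, Q_a)` of `V`. -/
structure ThickeningFrame (D : T →ₗ[ℝ] V) (p : κ → T →ₗ[ℝ] ℝ) (B : V →ₗ[ℝ] V →ₗ[ℝ] ℝ)
    (Z : ι → V) (Q : κ → V) (e : ι → T) (E P : κ → T) : Prop where
  D_e : ∀ i, D (e i) = Z i
  -- This value is forced by σ(e_i, E_b) = 0, since σ(e_i, E_b) = B(Z_i, Q_b) − p_b(e_i).
  p_e : ∀ b i, p b (e i) = -B (Q b) (Z i)
  D_E : ∀ a, D (E a) = Q a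
  p_E : ∀ b a, p b (E a) = 0
  D_P : ∀ a, D (P a) = 0
  p_P : ∀ b a, p b (P a) = if b = a then 1 else 0

namespace ThickeningModel

variable {σ : T →ₗ[ℝ] T →ₗ[ℝ] ℝ} {D : T →ₗ[ℝ] V} {p : κ → T →ₗ[ℝ] ℝ}
    {B : V →ₗ[ℝ] V →ₗ[ℝ] ℝ} {Z : ι → V} {Q : κ → V} {η : ι → V →ₗ[ℝ] ℝ} {f : κ → V →ₗ[ℝ] ℝ}
    {e : ι → T} {E P : κ → T}

/-- σ(u, ·) depends on u only through D u and the p_b u, so non-degeneracy makes (D, p) injective.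
-/
theorem eq_of_D_eq_of_p_eq (m : ThickeningModel σ D p B Z Q η f) {u v : T} (h : D u = D v)
    (h' : ∀ b, p b u = p b v) : u = v := by
  rw [← sub_eq_zero]
  refine m.nondegenerate _ fun w => ?_
  rw [m.apply_eq, map_sub, h, sub_self]
  simp [h']

/-- The coefficient of `P_a` in the frame `(e_i, E_a, P_a)`. -/
def vertCoeff (D : T →ₗ[ℝ] V) (p : κ → T →ₗ[ℝ] ℝ) (B : V →ₗ[ℝ] V →ₗ[ℝ] ℝ) (Z : ι → V) (Q : κ → V)
    (η : ι → V →ₗ[ℝ] ℝ) (a : κ) : T →ₗ[ℝ] ℝ :=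
  p a + ∑ i, B (Q a) (Z i) • η i ∘ₗ D

theorem vertCoeff_apply (a : κ) (u : T) :
    vertCoeff D p B Z Q η a u = p a u + ∑ i, B (Q a) (Z i) * η i (D u) := by
  simp [vertCoeff, LinearMap.sum_apply]

theorem eq_comb (m : ThickeningModel σ D p B Z Q η f) (F : ThickeningFrame D p B Z Q e E P)
    (u : T) : u = AdaptedFrame.comb e E P (fun i => η i (D u)) (fun a => f a (D u))
      (fun a => vertCoeff D p B Z Q η a u) := by
  refine m.eq_of_D_eq_of_p_eq ?_ fun b => ?_
  · simp only [AdaptedFrame.comb, Fintype.linearCombination_apply, map_add, map_sum, map_smul,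
      F.D_P, F.D_E, F.D_e, smul_zero, Finset.sum_const_zero, add_zero]
    exact m.eq_sum _
  · simp only [AdaptedFrame.comb, Fintype.linearCombination_apply, map_add, map_sum, map_smul,
      F.p_P, F.p_E, F.p_e, Finset.sum_const_zero,
      add_zero, smul_eq_mul, mul_ite, mul_one, mul_zero, Finset.sum_ite_eq, Finset.mem_univ,
      if_true, vertCoeff_apply]
    simp [mul_comm]

theorem adaptedFrame (m : ThickeningModel σ D p B Z Q η f)
    (F : ThickeningFrame D p B Z Q e E P) :
    AdaptedFrame σ e E P (Matrix.of fun i j => B (Z i) (Z j)) where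
  swap := m.swap
  e_e i j := by simp [m.apply_eq, F.D_e, m.f_Z]
  e_E i a := by simp [m.apply_eq, F.D_e, F.D_E, F.p_e, m.f_Z, m.f_Q, m.B_swap (Z i)]
  e_P i a := by simp [m.apply_eq, F.D_e, F.D_P, m.f_Z]
  E_E a b := by simp [m.apply_eq, F.D_E, F.p_E, m.B_Q]
  E_P a b := by simp [m.apply_eq, F.D_E, F.D_P, F.p_E, F.p_P, m.f_Q, eq_comm]
  P_P a b := by simp [m.apply_eq, F.D_P]
  exists_eq u := ⟨_, _, _, m.eq_comb F u⟩

theorem D_comb (F : ThickeningFrame D p B Z Q e E P) (h : ι → ℝ) (x y : κ → ℝ) :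
    D (AdaptedFrame.comb e E P h x y) = ∑ i, h i • Z i + ∑ a, x a • Q a := by
  simp [AdaptedFrame.comb, Fintype.linearCombination_apply, F.D_P, F.D_E, F.D_e]

theorem η_D_comb (m : ThickeningModel σ D p B Z Q η f) (F : ThickeningFrame D p B Z Q e E P)
    (h : ι → ℝ) (x y : κ → ℝ) (i : ι) : η i (D (AdaptedFrame.comb e E P h x y)) = h i := by
  rw [D_comb F]
  simp [m.η_Q, m.η_Z]

theorem f_D_comb (m : ThickeningModel σ D p B Z Q η f) (F : ThickeningFrame D p B Z Q e E P)
    (h : ι → ℝ) (x y : κ → ℝ) (a : κ) : f a (D (AdaptedFrame.comb e E P h x y)) = x a := by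
  rw [D_comb F]
  simp [m.f_Q, m.f_Z]

theorem linearIndependent_e (m : ThickeningModel σ D p B Z Q η f)
    (F : ThickeningFrame D p B Z Q e E P) : LinearIndependent ℝ e := by
  refine Fintype.linearIndependent_iff.2 fun h hh i => ?_
  have h0 : AdaptedFrame.comb e E P h 0 0 = 0 := by
    simpa [AdaptedFrame.comb, Fintype.linearCombination_apply] using hh
  rw [← m.η_D_comb F h 0 0 i, h0, map_zero, map_zero]

theorem isUnit_gram (m : ThickeningModel σ D p B Z Q η f) (F : ThickeningFrame D p B Z Q e E P) :
    IsUnit (Matrix.of fun i j => B (Z i) (Z j)) :=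
  (m.adaptedFrame F).isUnit m.nondegenerate (m.linearIndependent_e F)

variable {K G : Submodule ℝ T}

/-- K contains every E_a and P_a, and pairing with them kills all but the e-coordinates. Conversely
a vector of K has no e-coordinates, hence is orthogonal to each e_i. -/
theorem span_range_e (m : ThickeningModel σ D p B Z Q η f)
    (F : ThickeningFrame D p B Z Q e E P) (hK : ∀ u, u ∈ K ↔ ∀ i, η i (D u) = 0)
    (hG : ∀ u, u ∈ G ↔ ∀ w ∈ K, σ u w = 0) : Submodule.span ℝ (range e) = G := by
  apply le_antisymm
  · rw [Submodule.span_le]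
    rintro _ ⟨i, rfl⟩
    refine (hG _).2 fun w hw => ?_
    rw [m.eq_comb F w, funext ((hK w).1 hw)]
    simp [AdaptedFrame.comb, Fintype.linearCombination_apply, (m.adaptedFrame F).e_E,
      (m.adaptedFrame F).e_P]
  · intro u hu
    obtain ⟨h, x, y, rfl⟩ := (m.adaptedFrame F).exists_eq u
    have hx : x = 0 := funext fun a => by
      rw [← (m.adaptedFrame F).comb_P h x y]
      exact (hG _).1 hu _ ((hK _).2 fun i => by rw [F.D_P, map_zero])
    have hy : y = 0 := funext fun a => by
      rw [Pi.zero_apply, ← neg_eq_zero, ← (m.adaptedFrame F).comb_E h x y]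
      exact (hG _).1 hu _ ((hK _).2 fun i => by rw [F.D_E, m.η_Q])
    rw [hx, hy, map_zero, map_zero, add_zero, add_zero, ← Fintype.range_linearCombination]
    exact ⟨h, rfl⟩

theorem mem_sup_iff (m : ThickeningModel σ D p B Z Q η f)
    (F : ThickeningFrame D p B Z Q e E P) (hK : ∀ u, u ∈ K ↔ ∀ i, η i (D u) = 0)
    (hG : ∀ u, u ∈ G ↔ ∀ w ∈ K, σ u w = 0) (u : T) :
    u ∈ G ⊔ Submodule.span ℝ (range E) ↔ ∃ h x, u = AdaptedFrame.comb e E P h x 0 := by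
  rw [← m.span_range_e F hK hG, ← Fintype.range_linearCombination,
    ← Fintype.range_linearCombination, Submodule.mem_sup]
  simp only [LinearMap.mem_range, exists_exists_eq_and, AdaptedFrame.comb, map_zero, add_zero]
  exact exists_congr fun h => exists_congr fun x => eq_comm

/-- D carries the e_i and E_a to the frame of V and kills the P_a. -/
theorem isCompl (m : ThickeningModel σ D p B Z Q η f)
    (F : ThickeningFrame D p B Z Q e E P) (hK : ∀ u, u ∈ K ↔ ∀ i, η i (D u) = 0)
    (hG : ∀ u, u ∈ G ↔ ∀ w ∈ K, σ u w = 0) :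
    IsCompl (LinearMap.ker D) (G ⊔ Submodule.span ℝ (range E)) := by
  constructor
  · rw [Submodule.disjoint_def]
    intro u hu hu'
    obtain ⟨h, x, rfl⟩ := (m.mem_sup_iff F hK hG u).1 hu'
    have hh : h = 0 := funext fun i => by
      rw [← m.η_D_comb F h x 0, LinearMap.mem_ker.1 hu, map_zero, Pi.zero_apply]
    have hx : x = 0 := funext fun i => by
      rw [← m.f_D_comb F h x 0, LinearMap.mem_ker.1 hu, map_zero, Pi.zero_apply]
    simp [hh, hx, AdaptedFrame.comb]
  · rw [codisjoint_iff_le_sup]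
    intro u _
    rw [m.eq_comb F u]
    refine Submodule.add_mem _ (Submodule.mem_sup_right ((m.mem_sup_iff F hK hG _).2
      ⟨fun i => η i (D u), fun a => f a (D u), ?_⟩)) (Submodule.mem_sup_left ?_)
    · simp [AdaptedFrame.comb]
    · simp [Fintype.linearCombination_apply, F.D_P]

/-- The vertical part of u is its P-component, and p_a reads off its coefficients. This identifies
∇s with coordinates in the adapted frame. -/
theorem p_projAlong (m : ThickeningModel σ D p B Z Q η f)
    (F : ThickeningFrame D p B Z Q e E P) (hK : ∀ u, u ∈ K ↔ ∀ i, η i (D u) = 0)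
    (hG : ∀ u, u ∈ G ↔ ∀ w ∈ K, σ u w = 0) (a : κ) (u : T) :
    p a (projAlong (LinearMap.ker D) (G ⊔ Submodule.span ℝ (range E)) u) =
      vertCoeff D p B Z Q η a u := by
  have hc := m.isCompl F hK hG
  have h1 : AdaptedFrame.comb e E P (fun i => η i (D u)) (fun a => f a (D u)) 0 ∈
      G ⊔ Submodule.span ℝ (range E) := (m.mem_sup_iff F hK hG _).2 ⟨_, _, rfl⟩
  have h2 : Fintype.linearCombination ℝ P (fun a => vertCoeff D p B Z Q η a u) ∈
      LinearMap.ker D := by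
    simp [Fintype.linearCombination_apply, F.D_P]
  have h3 : u = AdaptedFrame.comb e E P (fun i => η i (D u)) (fun a => f a (D u)) 0 +
      Fintype.linearCombination ℝ P (fun a => vertCoeff D p B Z Q η a u) := by
    conv_lhs => rw [m.eq_comb F u]
    simp [AdaptedFrame.comb]
  have h4 : projAlong (LinearMap.ker D) (G ⊔ Submodule.span ℝ (range E)) u =
      Fintype.linearCombination ℝ P (fun a => vertCoeff D p B Z Q η a u) := by
    -- The subspaces are complementary, so the default value 0 of `projAlong` does not occur.
    rw [projAlong, dif_pos hc]
    conv_lhs => rw [h3]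
    rw [map_add, Submodule.projection_apply_of_mem_left hc h2,
      (Submodule.projection_apply_eq_zero_iff hc).2 h1, zero_add]
  rw [h4]
  simp [Fintype.linearCombination_apply, F.p_P]

variable {s : V →ₗ[ℝ] T}

/-- A section is determined by its vertical coefficients on the frame of V; these are the matrices N
and M of the abstract criterion. -/
theorem mem_range_section_iff (m : ThickeningModel σ D p B Z Q η f)
    (F : ThickeningFrame D p B Z Q e E P) (hs : ∀ v, D (s v) = v) (u : T) :
    u ∈ LinearMap.range s ↔ ∃ h x, u = AdaptedFrame.comb e E P h x
      ((Matrix.of fun i a => vertCoeff D p B Z Q η a (s (Z i)))ᵀ *ᵥ h +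
        (Matrix.of fun b a => vertCoeff D p B Z Q η a (s (Q b)))ᵀ *ᵥ x) := by
  have key : ∀ h x, s (∑ i, h i • Z i + ∑ b, x b • Q b) = AdaptedFrame.comb e E P h x
      ((Matrix.of fun i a => vertCoeff D p B Z Q η a (s (Z i)))ᵀ *ᵥ h +
        (Matrix.of fun b a => vertCoeff D p B Z Q η a (s (Q b)))ᵀ *ᵥ x) := by
    intro h x
    rw [m.eq_comb F (s _)]
    have h1 : (fun i => η i (∑ i, h i • Z i + ∑ b, x b • Q b)) = h := by
      ext i; simp [m.η_Q, m.η_Z]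
    have h2 : (fun a => f a (∑ i, h i • Z i + ∑ b, x b • Q b)) = x := by
      ext i; simp [m.f_Q, m.f_Z]
    rw [hs, h1, h2]
    congr 1
    ext a
    simp [mulVec, dotProduct, mul_comm]
  constructor
  · rintro ⟨v, rfl⟩
    refine ⟨fun i => η i v, fun a => f a v, ?_⟩
    rw [← key, ← m.eq_sum v]
  · rintro ⟨h, x, rfl⟩
    rw [← key]
    exact ⟨_, rfl⟩

variable {L' : Submodule ℝ T}

/-- The orthogonal of the image of a section is contained in it iff the master equation holds. -/
theorem orth_range_le_iff (m : ThickeningModel σ D p B Z Q η f)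
    (F : ThickeningFrame D p B Z Q e E P) (hs : ∀ v, D (s v) = v)
    (hL' : ∀ u, u ∈ L' ↔ ∀ w ∈ LinearMap.range s, σ u w = 0) :
    L' ≤ LinearMap.range s ↔ ∀ a b,
      ∑ i, ∑ j, vertCoeff D p B Z Q η a (s (Z i)) *
        ((Matrix.of fun i j => B (Z i) (Z j))⁻¹)ᵀ i j * vertCoeff D p B Z Q η b (s (Z j)) =
      vertCoeff D p B Z Q η a (s (Q b)) - vertCoeff D p B Z Q η b (s (Q a)) := by
  rw [(m.adaptedFrame F).orth_le_iff (m.isUnit_gram F) (m.mem_range_section_iff F hs) hL',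
    ← Matrix.ext_iff]
  refine forall_congr' fun a => forall_congr' fun b => ?_
  rw [Matrix.mul_assoc, mul_apply]
  simp only [mul_apply, Finset.mul_sum, transpose_apply, of_apply, Matrix.sub_apply, mul_assoc]

theorem finrank_orth_range (m : ThickeningModel σ D p B Z Q η f)
    (F : ThickeningFrame D p B Z Q e E P) (hs : ∀ v, D (s v) = v)
    (hL' : ∀ u, u ∈ L' ↔ ∀ w ∈ LinearMap.range s, σ u w = 0) :
    Module.finrank ℝ L' = Fintype.card κ :=
  (m.adaptedFrame F).finrank_orth (m.isUnit_gram F) (m.mem_range_section_iff F hs) hL'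

end ThickeningModel

end Model

/-! ### The adapted frame of TE* at a point over a foliation chart. -/

theorem _root_.ContinuousLinearMap.isInvertible_of_injective_of_finrank_eq {E F : Type*}
    [NormedAddCommGroup E] [NormedSpace ℝ E] [NormedAddCommGroup F] [NormedSpace ℝ F]
    [FiniteDimensional ℝ E] [FiniteDimensional ℝ F] {A : E →L[ℝ] F} (hA : Injective A)
    (h : Module.finrank ℝ E = Module.finrank ℝ F) : A.IsInvertible :=
  ⟨(LinearEquiv.ofInjectiveOfFinrankEq A.toLinearMap hA h).toContinuousLinearEquiv, by
    ext x; rfl⟩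

theorem _root_.Module.finrank_dualFib (r : ℕ) : Module.finrank ℝ (DualFib r) = r := by
  rw [← (LinearMap.toContinuousLinearMap (𝕜 := ℝ) (E := Fib r) (F' := ℝ)).finrank_eq,
    Module.finrank_linearMap]
  simp

namespace FoliationChart

section Frame

variable {k r : ℕ} {Y : Type*} [TopologicalSpace Y]
  [ChartedSpace (EuclideanSpace ℝ (Fin (2 * k + r))) Y] [IsManifold (𝓡 (2 * k + r)) ∞ Y]
  {Ω : Form (𝓡 (2 * k + r)) Y 2}
  [TopologicalSpace (TotalSpace (Fib r) (NullDist Ω))]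
  [FiberBundle (Fib r) (NullDist Ω)] [VectorBundle ℝ (Fib r) (NullDist Ω)]
  [ContMDiffVectorBundle ∞ (Fib r) (NullDist Ω) (𝓡 (2 * k + r))]
  {S : Splitting Ω} {φ : FoliationChart Ω} {l : EDual Ω}

theorem thickeningModel (hE : IsSubbundle Ω) (hl : l.proj ∈ φ.chart.source)
    (hnd : S.omega.ker l = ⊥) :
    ThickeningModel (toBilin (S.omega l)) (dπ l).toLinearMap (fun b => (φ.dp S b l).toLinearMap)
      (φ.baseForm S l) (fun i => φ.hor S i l.proj) (fun a => φ.dq a l.proj)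
      (fun i => φ.yComp i l.proj) (fun b => φ.fstar S b l.proj) where
  eq_sum := eq_sum_hor_add_sum_dq hl
  f_Q := fstar_dq hl
  f_Z := fstar_hor hl
  η_Q i a := congrArg (fun w => w.1 i) (deriv_dq hl a)
  η_Z i j := (congrArg (fun w => w.1 i) (deriv_hor (S := S) hl j)).trans (by simp)
  B_swap := baseForm_swap
  B_Q := baseForm_dq hl
  swap := toBilin_swap _
  apply_eq := omega_apply hE hl
  nondegenerate u hu := by
    rw [← Submodule.mem_bot ℝ, ← hnd]
    exact fun w _ => hu w

/-- Injectivity comes from non-degeneracy of ω_U, since a vector killed by all dy, dq and dp is in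
its kernel; both spaces have dimension 2k + 2r. -/
theorem isInvertible_coordDeriv (hE : IsSubbundle Ω) (hl : l.proj ∈ φ.chart.source)
    (hnd : S.omega.ker l = ⊥) : (φ.coordDeriv S l).IsInvertible := by
  have hinj : Injective (φ.coordDeriv S l) := fun u v huv => by
    rw [coordDeriv_apply hl, coordDeriv_apply hl] at huv
    refine (thickeningModel (φ := φ) hE hl hnd).eq_of_D_eq_of_p_eq
      (deriv_injective hl (congrArg Prod.fst huv)) fun b => ?_
    exact congrFun (congrArg WithLp.ofLp (congrArg Prod.snd huv)) b
  refine ContinuousLinearMap.isInvertible_of_injective_of_finrank_eq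
    (E := EuclideanSpace ℝ (Fin (2 * k + r)) × DualFib r) hinj ?_
  simp [Module.finrank_prod, Module.finrank_dualFib]

theorem deriv_dπ_inverse (hE : IsSubbundle Ω) (hl : l.proj ∈ φ.chart.source)
    (hnd : S.omega.ker l = ⊥) (w : (EuclideanSpace ℝ (Fin (2 * k)) × EuclideanSpace ℝ (Fin r)) ×
      EuclideanSpace ℝ (Fin r)) :
    φ.deriv l.proj (dπ l ((φ.coordDeriv S l).inverse w)) = w.1 := by
  have h := congrArg Prod.fst ((isInvertible_coordDeriv hE hl hnd).self_apply_inverse w)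
  rwa [coordDeriv_apply hl] at h

theorem dp_inverse (hE : IsSubbundle Ω) (hl : l.proj ∈ φ.chart.source)
    (hnd : S.omega.ker l = ⊥) (w : (EuclideanSpace ℝ (Fin (2 * k)) × EuclideanSpace ℝ (Fin r)) ×
      EuclideanSpace ℝ (Fin r)) (b : Fin r) :
    φ.dp S b l ((φ.coordDeriv S l).inverse w) = w.2 b := by
  have h := congrArg Prod.snd ((isInvertible_coordDeriv hE hl hnd).self_apply_inverse w)
  rw [coordDeriv_apply hl] at h
  exact congrFun (congrArg WithLp.ofLp h) b

variable (φ S) in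
/-- The coordinate vector `∂/∂p_a` on `E*`. -/
def vert (a : Fin r) (l : EDual Ω) : TangentSpace (IDual k r) l :=
  (φ.coordDeriv S l).inverse (0, EuclideanSpace.single a 1)

variable (φ S) in
/-- The lift `e_i` of `Y_i` to the leafwise symplectic connection. -/
def horLift (i : Fin (2 * k)) (l : EDual Ω) : TangentSpace (IDual k r) l :=
  (φ.coordDeriv S l).inverse (φ.deriv l.proj (φ.hor S i l.proj),
    WithLp.toLp 2 fun b => -φ.baseForm S l (φ.dq b l.proj) (φ.hor S i l.proj))

theorem thickeningFrame (hE : IsSubbundle Ω) (hl : l.proj ∈ φ.chart.source)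
    (hnd : S.omega.ker l = ⊥) :
    ThickeningFrame (dπ l).toLinearMap (fun b => (φ.dp S b l).toLinearMap)
      (φ.baseForm S l) (fun i => φ.hor S i l.proj) (fun a => φ.dq a l.proj)
      (fun i => φ.horLift S i l) (fun a => φ.f S a l) (fun a => φ.vert S a l) where
  D_e i := deriv_injective hl (deriv_dπ_inverse hE hl hnd _)
  p_e b i := dp_inverse hE hl hnd _ b
  D_E a := deriv_injective hl ((deriv_dπ_inverse hE hl hnd _).trans (deriv_dq hl a).symm)
  p_E b a := dp_inverse hE hl hnd _ b
  D_P a := deriv_injective hl ((deriv_dπ_inverse hE hl hnd _).trans (map_zero _).symm)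
  p_P b a := (dp_inverse hE hl hnd _ b).trans (by simp)

theorem mem_foliationTangent_iff (hl : l.proj ∈ φ.chart.source) (u : TangentSpace (IDual k r) l) :
    u ∈ foliationTangent l ↔ ∀ i, φ.yComp i l.proj ((dπ l).toLinearMap u) = 0 := by
  have h : u ∈ foliationTangent l ↔ dπ l u ∈ Ω.ker l.proj := Iff.rfl
  rw [h, mem_ker_iff_deriv hl]
  exact ⟨fun h i => congrArg (fun w => w i) h, fun h => by ext i; exact h i⟩

theorem mem_GSharp_iff (u : TangentSpace (IDual k r) l) :
    u ∈ S.GSharp l ↔ ∀ w ∈ foliationTangent l, toBilin (S.omega l) u w = 0 :=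
  Iff.rfl

theorem dπ_dSec {s : (y : Y) → NullDist Ω y →L[ℝ] ℝ}
    (hs : ContMDiff (𝓡 (2 * k + r)) (IDual k r) ∞ (graphMap s : Y → EDual Ω)) (y : Y)
    (v : TangentSpace (𝓡 (2 * k + r)) y) : dπ (graphMap s y) (dSec s y v) = v := by
  have h := mfderiv_comp (g := fun l : EDual Ω => l.proj) (f := graphMap s) y
    ((contMDiffAt_base _).mdifferentiableAt (by simp)) ((hs y).mdifferentiableAt (by simp))
  have h' : (fun l : EDual Ω => l.proj) ∘ graphMap s = id := rfl
  rw [h', mfderiv_id] at h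
  exact (DFunLike.congr_fun h v).symm

/-! ### The covariant derivative and the forms of the master equation. -/

section Master

variable {s : (y : Y) → NullDist Ω y →L[ℝ] ℝ} {y : Y}

variable (φ S) in
/-- The coefficient of `∂/∂p_a` of a tangent vector of `E*` in the frame
`(e_i, ∂/∂q^a, ∂/∂p_a)`. -/
def vertCoeff (a : Fin r) (l : EDual Ω) : TangentSpace (IDual k r) l →ₗ[ℝ] ℝ :=
  ThickeningModel.vertCoeff (dπ l).toLinearMap (fun b => (φ.dp S b l).toLinearMap)
    (φ.baseForm S l) (fun i => φ.hor S i l.proj) (fun a => φ.dq a l.proj)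
    (fun i => φ.yComp i l.proj) a

theorem nabla_eq (hE : IsSubbundle Ω) (hy : y ∈ φ.chart.source)
    (hnd : S.omega.ker (graphMap s y) = ⊥) (v : TangentSpace (𝓡 (2 * k + r)) y) (a : Fin r) :
    φ.nabla S s y v a = φ.vertCoeff S a (graphMap s y) (dSec s y v) := by
  have hy' : (graphMap s y).proj ∈ φ.chart.source := hy
  rw [nabla, coordDeriv_apply hy']
  exact (thickeningModel hE hy' hnd).p_projAlong (thickeningFrame hE hy' hnd)
    (mem_foliationTangent_iff hy') mem_GSharp_iff a _

theorem gram_eq_omegaTilde (hE : IsSubbundle Ω) (hy : y ∈ φ.chart.source) :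
    (Matrix.of fun i j => φ.baseForm S (graphMap s y) (φ.hor S i y) (φ.hor S j y)) =
      φ.omegaTilde S s y := by
  ext i j
  exact baseForm_hor (l := graphMap s y) hE hy i j

theorem isUnit_omegaTilde (hE : IsSubbundle Ω) (hy : y ∈ φ.chart.source)
    (hnd : S.omega.ker (graphMap s y) = ⊥) : IsUnit (φ.omegaTilde S s y) := by
  have hy' : (graphMap s y).proj ∈ φ.chart.source := hy
  rw [← gram_eq_omegaTilde hE hy]
  exact (thickeningModel hE hy' hnd).isUnit_gram (thickeningFrame hE hy' hnd)

theorem isCompl_vertical (hE : IsSubbundle Ω) (hl : l.proj ∈ φ.chart.source)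
    (hnd : S.omega.ker l = ⊥) : IsCompl (vertical l) (S.GSharp l ⊔ φ.ESharp S l) :=
  (thickeningModel hE hl hnd).isCompl (thickeningFrame hE hl hnd)
    (mem_foliationTangent_iff hl) mem_GSharp_iff

theorem span_range_horLift (hE : IsSubbundle Ω) (hl : l.proj ∈ φ.chart.source)
    (hnd : S.omega.ker l = ⊥) :
    Submodule.span ℝ (range fun i => φ.horLift S i l) = S.GSharp l :=
  (thickeningModel hE hl hnd).span_range_e (thickeningFrame hE hl hnd)
    (mem_foliationTangent_iff hl) mem_GSharp_iff

theorem isCoisotropicAt_iff_forall (hE : IsSubbundle Ω)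
    (hs : ContMDiff (𝓡 (2 * k + r)) (IDual k r) ∞ (graphMap s : Y → EDual Ω))
    (hy : y ∈ φ.chart.source) (hnd : S.omega.ker (graphMap s y) = ⊥) :
    S.IsCoisotropicAt s y ↔
      ∀ a b, φ.quad S s y a b = φ.nablaE S s y b a - φ.nablaE S s y a b := by
  have hy' : (graphMap s y).proj ∈ φ.chart.source := hy
  have h := (thickeningModel hE hy' hnd).orth_range_le_iff (thickeningFrame hE hy' hnd)
    (s := (dSec s y).toLinearMap) (L' := S.omega.orth (graphTangent s y)) (dπ_dSec hs y)
    (fun u => Iff.rfl)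
  refine h.trans (forall_congr' fun a => forall_congr' fun b => ?_)
  simp only [quad, nablaG, nablaE, nabla_eq hE hy hnd, omegaTildeInv, ← gram_eq_omegaTilde hE hy]
  rfl

theorem finrank_orth_graphTangent (hE : IsSubbundle Ω)
    (hs : ContMDiff (𝓡 (2 * k + r)) (IDual k r) ∞ (graphMap s : Y → EDual Ω))
    (hy : y ∈ φ.chart.source) (hnd : S.omega.ker (graphMap s y) = ⊥) :
    Module.finrank ℝ (S.omega.orth (graphTangent s y)) = r := by
  have hy' : (graphMap s y).proj ∈ φ.chart.source := hy
  have h := (thickeningModel hE hy' hnd).finrank_orth_range (thickeningFrame hE hy' hnd)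
    (s := (dSec s y).toLinearMap) (L' := S.omega.orth (graphTangent s y)) (dπ_dSec hs y)
    (fun u => Iff.rfl)
  rwa [Fintype.card_fin] at h

/-- ω̃ is antisymmetric, hence so is its inverse. -/
theorem quad_swap (hE : IsSubbundle Ω) (hy : y ∈ φ.chart.source)
    (hnd : S.omega.ker (graphMap s y) = ⊥) (a b : Fin r) :
    φ.quad S s y a b = -φ.quad S s y b a := by
  have h : (φ.omegaTilde S s y).transpose = -φ.omegaTilde S s y := by
    rw [← gram_eq_omegaTilde hE hy]
    ext i j
    exact baseForm_swap _ _
  have h' : ∀ i j, φ.omegaTildeInv S s y i j = -φ.omegaTildeInv S s y j i := by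
    intro i j
    have e : (φ.omegaTilde S s y)⁻¹.transpose = -(φ.omegaTilde S s y)⁻¹ := by
      have hdet := (Matrix.isUnit_iff_isUnit_det _).1 (isUnit_omegaTilde hE hy hnd)
      rw [Matrix.transpose_nonsing_inv, h]
      exact Matrix.inv_eq_right_inv (by rw [neg_mul_neg, Matrix.mul_nonsing_inv _ hdet])
    exact congrFun (congrFun e i) j
  rw [quad, quad, Finset.sum_comm, ← Finset.sum_neg_distrib]
  refine Finset.sum_congr rfl fun i _ => ?_
  rw [← Finset.sum_neg_distrib]
  refine Finset.sum_congr rfl fun j _ => ?_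
  rw [h' j i]
  ring

/-- Both sides are antisymmetric in (a, b): the diagonal equations are trivial and those with a < b
repeat those with a > b. -/
theorem forall_iff_masterComp (hE : IsSubbundle Ω) (hy : y ∈ φ.chart.source)
    (hnd : S.omega.ker (graphMap s y) = ⊥) :
    (∀ a b, φ.quad S s y a b = φ.nablaE S s y b a - φ.nablaE S s y a b) ↔
      φ.MasterComp S s y := by
  refine ⟨fun h a b _ => h a b, fun h a b => ?_⟩
  rcases lt_trichotomy b a with hab | rfl | hab
  · exact h a b hab
  · have := quad_swap (S := S) (s := s) hE hy hnd b b
    linarith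
  · have h1 := quad_swap (S := S) (s := s) hE hy hnd a b
    have h2 := h b a hab
    linarith

/-- Only the antisymmetric part of the coefficients survives. It is X_ab − X_ba, which accounts for
the factor ½ before an already antisymmetric `quad`. -/
theorem sum_smul_wedge_apply (X : Fin r → Fin r → ℝ) (u v : TangentSpace (𝓡 (2 * k + r)) y) :
    (∑ a, ∑ b, X a b • wedge (φ.fstar S a y) (φ.fstar S b y)) u v =
      ∑ a, ∑ b, (X a b - X b a) * (φ.fstar S a y u * φ.fstar S b y v) := by
  have h : (∑ a, ∑ b, X a b • wedge (φ.fstar S a y) (φ.fstar S b y)) u v =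
      ∑ a, ∑ b, X a b * (φ.fstar S a y u * φ.fstar S b y v) -
        ∑ a, ∑ b, X a b * (φ.fstar S b y u * φ.fstar S a y v) := by
    simp only [LinearMap.sum_apply, wedge, ← Finset.sum_sub_distrib]
    simp [mul_sub]
  rw [h, Finset.sum_comm (f := fun a b => X a b * (φ.fstar S b y u * φ.fstar S a y v)),
    ← Finset.sum_sub_distrib]
  refine Finset.sum_congr rfl fun a _ => ?_
  rw [← Finset.sum_sub_distrib]
  exact Finset.sum_congr rfl fun b _ => by ring

theorem forall_iff_masterForm (hE : IsSubbundle Ω) (hy : y ∈ φ.chart.source)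
    (hnd : S.omega.ker (graphMap s y) = ⊥) :
    (∀ a b, φ.quad S s y a b = φ.nablaE S s y b a - φ.nablaE S s y a b) ↔
      φ.MasterForm S s y := by
  have hq : ∀ a b, (1 / 2 : ℝ) * φ.quad S s y a b - (1 / 2 : ℝ) * φ.quad S s y b a =
      φ.quad S s y a b := fun a b => by
    rw [quad_swap (S := S) (s := s) hE hy hnd b a]
    ring
  constructor
  · intro h
    refine LinearMap.ext fun u => LinearMap.ext fun v => ?_
    rw [sum_smul_wedge_apply (fun a b => (1 / 2 : ℝ) * φ.quad S s y a b),
      sum_smul_wedge_apply (fun a b => φ.nablaE S s y b a)]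
    simp only [hq]
    simp only [h]
  · intro h c d
    -- Evaluation on (∂/∂q^c, ∂/∂q^d) isolates one coefficient, because the f_a^* are dual to the
    -- ∂/∂q^a on E.
    have h1 := LinearMap.congr_fun (LinearMap.congr_fun h (φ.dq c y)) (φ.dq d y)
    rw [sum_smul_wedge_apply (fun a b => (1 / 2 : ℝ) * φ.quad S s y a b),
      sum_smul_wedge_apply (fun a b => φ.nablaE S s y b a)] at h1
    simp only [hq] at h1
    simpa [fstar_dq hy] using h1

end Master

end Frame

end FoliationChart

end MasterEq

end

theorem mainTheorem3 {k r : ℕ} {Y : Type*} [TopologicalSpace Y]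
    [ChartedSpace (EuclideanSpace ℝ (Fin (2 * k + r))) Y] [IsManifold (𝓡 (2 * k + r)) ∞ Y]
    (Ω : MasterEq.Form (𝓡 (2 * k + r)) Y 2) (hΩ : Ω.IsPresymplectic r)
    [TopologicalSpace (TotalSpace (MasterEq.Fib r) (MasterEq.NullDist Ω))]
    [FiberBundle (MasterEq.Fib r) (MasterEq.NullDist Ω)]
    [VectorBundle ℝ (MasterEq.Fib r) (MasterEq.NullDist Ω)]
    [ContMDiffVectorBundle ∞ (MasterEq.Fib r) (MasterEq.NullDist Ω) (𝓡 (2 * k + r))]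
    (hE : MasterEq.IsSubbundle Ω) (S : MasterEq.Splitting Ω)
    (U : Set (MasterEq.EDual Ω)) (hU : S.IsThickening U)
    (s : (y : Y) → MasterEq.NullDist Ω y →L[ℝ] ℝ)
    (hs : ContMDiff (𝓡 (2 * k + r)) (MasterEq.IDual k r) ∞
      (MasterEq.graphMap s : Y → MasterEq.EDual Ω))
    (hsU : ∀ y, (MasterEq.graphMap s y : MasterEq.EDual Ω) ∈ U) :
    (∀ φ : MasterEq.FoliationChart Ω, ∀ y ∈ φ.chart.source,
      IsCompl (MasterEq.vertical (MasterEq.graphMap s y))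
        (S.GSharp (MasterEq.graphMap s y) ⊔ φ.ESharp S (MasterEq.graphMap s y)) ∧
      (∃ e : Fin (2 * k) →
          TangentSpace (MasterEq.IDual k r) (MasterEq.graphMap s y : MasterEq.EDual Ω),
        Submodule.span ℝ (Set.range e) = S.GSharp (MasterEq.graphMap s y) ∧
        (∀ i, MasterEq.dπ (MasterEq.graphMap s y) (e i) = φ.hor S i y) ∧
        ∀ i j, S.omega (MasterEq.graphMap s y) ![e i, e j] = φ.omegaTilde S s y i j) ∧
      IsUnit (φ.omegaTilde S s y) ∧
      (S.IsCoisotropicAt s y ↔ φ.MasterComp S s y) ∧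
      (S.IsCoisotropicAt s y ↔ φ.MasterForm S s y)) ∧
    (∀ A : Set (MasterEq.FoliationChart Ω), (∀ y, ∃ φ ∈ A, y ∈ φ.chart.source) →
      ((S.IsCoisotropicGraph s ↔ ∀ φ ∈ A, ∀ y ∈ φ.chart.source, φ.MasterComp S s y) ∧
       (S.IsCoisotropicGraph s ↔ ∀ φ ∈ A, ∀ y ∈ φ.chart.source, φ.MasterForm S s y))) := by
  have hnd : ∀ y, S.omega.ker (MasterEq.graphMap s y) = ⊥ := fun y =>
    hU.nondegenerate _ (hsU y)
  have hiff : ∀ φ : MasterEq.FoliationChart Ω, ∀ y ∈ φ.chart.source,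
      (S.IsCoisotropicAt s y ↔ φ.MasterComp S s y) ∧
      (S.IsCoisotropicAt s y ↔ φ.MasterForm S s y) := fun φ y hy => by
    have h := φ.isCoisotropicAt_iff_forall (S := S) hE hs hy (hnd y)
    exact ⟨h.trans (MasterEq.FoliationChart.forall_iff_masterComp hE hy (hnd y)),
      h.trans (MasterEq.FoliationChart.forall_iff_masterForm hE hy (hnd y))⟩
  refine ⟨fun φ y hy => ?_, fun A hA => ?_⟩
  · have hy' : (MasterEq.graphMap s y).proj ∈ φ.chart.source := hy
    have hF := MasterEq.FoliationChart.thickeningFrame (S := S) hE hy' (hnd y)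
    refine ⟨MasterEq.FoliationChart.isCompl_vertical hE hy' (hnd y),
      ⟨fun i => φ.horLift S i (MasterEq.graphMap s y),
        MasterEq.FoliationChart.span_range_horLift hE hy' (hnd y), hF.D_e, fun i j => ?_⟩,
      MasterEq.FoliationChart.isUnit_omegaTilde hE hy (hnd y), hiff φ y hy⟩
    rw [← MasterEq.FoliationChart.gram_eq_omegaTilde hE hy]
    exact ((MasterEq.FoliationChart.thickeningModel hE hy' (hnd y)).adaptedFrame hF).e_e i j
  -- The rank condition holds with d = r, since each point lies in some chart of the collection.
  · have hgraph : S.IsCoisotropicGraph s ↔ ∀ y, S.IsCoisotropicAt s y := by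
      refine ⟨fun h => h.1, fun h => ⟨h, r, fun y => ?_⟩⟩
      obtain ⟨φ, -, hy⟩ := hA y
      exact φ.finrank_orth_graphTangent hE hs hy (hnd y)
    rw [hgraph]
    constructor
    · refine ⟨fun h φ _ y hy => (hiff φ y hy).1.1 (h y), fun h y => ?_⟩
      obtain ⟨φ, hφ, hy⟩ := hA y
      exact (hiff φ y hy).1.2 (h φ hφ y hy)
    · refine ⟨fun h φ _ y hy => (hiff φ y hy).2.1 (h y), fun h y => ?_⟩
      obtain ⟨φ, hφ, hy⟩ := hA y
      exact (hiff φ y hy).2.2 (h φ hφ y hy)
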